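/- There is an absolute constant $\mu_0$ with the following property. Let $0<s\le 1$, $T>0$, $\mu\ge\mu_0$, and let $u$ be a solution on $[0,T]$, $2\pi$-periodic in $x$, of the cubic fractional nonlinear Schrödinger equation $$iu_t-(-\partial_{xx})^s u+|u|^2u=0,\qquad u(\cdot,0)=u_0,$$ that is continuously differentiable in time with values in the continuous $2\pi$-periodic functions and satisfies $u(t)\in H^\mu$ for $0\le t\le T$ with $\sup_{0\le t\le T}\|u(t)\|_\mu<\infty$. Here $(-\partial_{xx})^s$ is the Fourier multiplier $|m|^{2s}$, $H^\mu$ is the periodic $L^2$-based Sobolev space, and $\|\cdot\|$ is the norm of $L^2(-\pi,\pi)$. For $N\ge 1$ let $S_N=\mathrm{span}\{e^{imx}:|m|\le N\}$, let $P_N$ be the $L^2$-orthogonal projection onto $S_N$, put $F(v)=-i(-\partial_{xx})^s v+iP_N(|v|^2v)$ for $v\in S_N$, and let $u^N:[0,T]\to S_N$ be the solution of $\frac{d}{dt}u^N=F(u^N)$, $u^N(0)=P_Nu_0$. Let $b_1=b_3=\frac{1}{2-2^{1/3}}$ and $b_2=-\frac{2^{1/3}}{2-2^{1/3}}$ be the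 coefficients of Yoshida's three-stage, fourth-order composition of the implicit midpoint rule. Then there are constants $k_0>0$ and $C$, independent of $k$ and $N$, such that the following holds for all $N\ge1$ and all step sizes $0<k\le k_0$ with $Mk=T$ for a positive integer $M$, where in the case $s\le\frac12$ it is assumed in addition that $3\|P_Nu_0\|^2\,kN\max_{1\le j\le 3}|b_j|<1$. With $t_n=nk$, for all $Z^{n,0},\dots,Z^{n,3}\in S_N$ $(0\le n\le M-1)$ satisfying $$Z^{n,0}=u^N(t_n),\qquad Z^{n,j}=Z^{n,j-1}+kb_jF\Big(\frac{Z^{n,j}+Z^{n,j-1}}{2}\Big),\quad j=1,2,3,$$ the local temporal errors $\Theta^n=u^N(t_{n+1})-Z^{n,3}$ satisfy $$\max_{0\le n\le M-1}\|\Theta^n\|\le Ck^5 .$$ -/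

import Mathlib

namespace FNLS

noncomputable section

instance factTwoPiPos : Fact (0 < 2 * Real.pi) := ⟨Real.two_pi_pos⟩

/-- The circle `ℝ / 2πℤ`; functions on it are the `2π`-periodic functions. Mathlib's
`fourier m` is then `x ↦ e^{imx}`, `fourierCoeff v m` is `(1/2π) ∫_{-π}^{π} v(x) e^{-imx} dx`,
and the measure `volume` has total mass `2π`. -/
abbrev Circ : Type := AddCircle (2 * Real.pi)

/-- The `L²(-π, π)` norm (with respect to `dx`, total mass `2π`). -/
def l2Norm (v : C(Circ, ℂ)) : ℝ :=
  Real.sqrt (∫ x : Circ, ‖v x‖ ^ 2)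

/-- Membership in the periodic Sobolev space `H^μ`. -/
def MemSobolev (μ : ℝ) (v : C(Circ, ℂ)) : Prop :=
  Summable fun m : ℤ => (1 + (m : ℝ) ^ 2) ^ μ * ‖fourierCoeff v m‖ ^ 2

/-- The norm of `H^μ`. -/
def sobolevNorm (μ : ℝ) (v : C(Circ, ℂ)) : ℝ :=
  Real.sqrt (∑' m : ℤ, (1 + (m : ℝ) ^ 2) ^ μ * ‖fourierCoeff v m‖ ^ 2)

/-- The `m`-th term `|m|^{2s} v̂_m e^{imx}` of the Fourier series of `(-∂ₓₓ)^s v`. -/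
def fracLapTerm (s : ℝ) (v : C(Circ, ℂ)) (m : ℤ) : C(Circ, ℂ) :=
  (((|(m : ℝ)| ^ (2 * s) : ℝ) : ℂ) * fourierCoeff v m) • (fourier m : C(Circ, ℂ))

/-- The fractional Laplacian `(-∂ₓₓ)^s`, as the sum of a uniformly convergent Fourier series
(a finite sum when `v` is a trigonometric polynomial). -/
def fracLap (s : ℝ) (v : C(Circ, ℂ)) : C(Circ, ℂ) :=
  ∑' m : ℤ, fracLapTerm s v m

/-- The cubic nonlinearity `f(v) = |v|² v`. -/
def cubic (v : C(Circ, ℂ)) : C(Circ, ℂ) where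
  toFun x := ((‖v x‖ ^ 2 : ℝ) : ℂ) * v x
  continuous_toFun := by fun_prop

/-- `u` is a solution on `[0, T]` of `i u_t - (-∂ₓₓ)^s u + |u|² u = 0` with periodic boundary
conditions. The summability clause says that the series of `(-∂ₓₓ)^s u(t)` converges. -/
structure IsSolution (s T : ℝ) (u : ℝ → C(Circ, ℂ)) : Prop where
  summable_fracLap : ∀ t ∈ Set.Icc 0 T, Summable (fracLapTerm s (u t))
  hasDeriv : ∀ t ∈ Set.Icc 0 T,
    HasDerivWithinAt u (-(Complex.I • fracLap s (u t)) + Complex.I • cubic (u t))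
      (Set.Icc 0 T) t

/-- The space `S_N` of trigonometric polynomials of degree at most `N`. -/
def trigPoly (N : ℕ) : Submodule ℂ C(Circ, ℂ) :=
  Submodule.span ℂ ((fun m : ℤ => (fourier m : C(Circ, ℂ))) '' {m : ℤ | |m| ≤ (N : ℤ)})

/-- The `L²`-orthogonal projection `P_N` onto `S_N`, `P_N v = ∑_{|m| ≤ N} v̂_m e^{imx}`. -/
def proj (N : ℕ) (v : C(Circ, ℂ)) : C(Circ, ℂ) :=
  ∑ m ∈ Finset.Icc (-(N : ℤ)) (N : ℤ), fourierCoeff v m • (fourier m : C(Circ, ℂ))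

/-- The right-hand side `F(v) = -i (-∂ₓₓ)^s v + i P_N f(v)` of the semidiscrete system. -/
def rhs (s : ℝ) (N : ℕ) (v : C(Circ, ℂ)) : C(Circ, ℂ) :=
  -(Complex.I • fracLap s v) + Complex.I • proj N (cubic v)

/-- `uN : [0, T] → S_N` solves the Fourier–Galerkin semidiscretization with initial value
`P_N u₀`. -/
structure IsSemidiscrete (s : ℝ) (N : ℕ) (T : ℝ) (u₀ : C(Circ, ℂ)) (uN : ℝ → C(Circ, ℂ)) :
    Prop where
  mem : ∀ t ∈ Set.Icc 0 T, uN t ∈ trigPoly N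
  hasDeriv : ∀ t ∈ Set.Icc 0 T, HasDerivWithinAt uN (rhs s N (uN t)) (Set.Icc 0 T) t
  initial : uN 0 = proj N u₀

/-- `Z 0, …, Z q` are the stages of one step of length `k`, started at `W`, of the `q`-stage
composition with coefficients `b` of the implicit midpoint rule for the semidiscrete system. -/
structure IsStages {q : ℕ} (b : Fin q → ℝ) (s : ℝ) (N : ℕ) (k : ℝ) (W : C(Circ, ℂ))
    (Z : Fin (q + 1) → C(Circ, ℂ)) : Prop where
  mem : ∀ j, Z j ∈ trigPoly N
  zero : Z 0 = W
  step : ∀ j : Fin q, Z j.succ =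
    Z j.castSucc + (k * b j) • rhs s N ((1 / 2 : ℝ) • (Z j.succ + Z j.castSucc))

/-- The coefficients `b₁ = b₃ = 1/(2 - 2^{1/3})`, `b₂ = -2^{1/3}/(2 - 2^{1/3})` of Yoshida's
three-stage, fourth-order method. -/
def yoshida : Fin 3 → ℝ :=
  ![1 / (2 - (2 : ℝ) ^ (1 / 3 : ℝ)),
    -(2 : ℝ) ^ (1 / 3 : ℝ) / (2 - (2 : ℝ) ^ (1 / 3 : ℝ)),
    1 / (2 - (2 : ℝ) ^ (1 / 3 : ℝ))]

end

end FNLS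

/-!
The proof is a consistency and stability argument in which every constant is uniform in `N`.

*Regularity.* On `S_N` the norm `wn N r v = ∑_{|m| ≤ N} (1 + |m|)^r |v̂_m|` is submultiplicative and
dominates the sup norm, and `(-∂ₓₓ)^s` loses at most two orders of it because `s ≤ 1`. The
semidiscrete solutions are bounded in `wn N 10` (`exists_wn_le`): for large `N` an `L²` energy
estimate shows that they are so close to `P_N u` that an inverse inequality applies, and for
bounded `N` conservation of the `L²` norm is enough. The regularity of `u` needed for this is
`H^12`.

*Consistency.* Since the vector field `F` is linear plus cubic, `F (W + k a + k² b + …)` can be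
expanded explicitly. Along a combination of the elementary differentials at `W` of order at most
four the remainder is `O(k⁴)` in `L²`, uniformly in `N` (`exists_series_bound`). A midpoint step
maps such combinations to such combinations up to `O(k⁵)`, acting on their coefficients by
`stepCoeff`. The order conditions say that the three steps turn the zero coefficients into the
Taylor coefficients of the flow (`stepCoeff_comp`), which, given `b₁ = b₃` and
`b₁ + b₂ + b₃ = 1`, comes down to `b₁³ + b₂³ + b₃³ = 0`.

*Stability.* The linear part of `F` is skew in `L²` and the cubic part is Lipschitz there, with a
constant controlled by sup norms. So a midpoint step depends stably on its data as soon as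
`k |b| ‖Y‖²` is small in the sup norm, where `Y` is the midpoint (`norm_toL2_step_sub_le`). The
stages are arbitrary solutions of the implicit equations, so this has to be extracted from those
equations. The `L²` norm of the stages is conserved. For `s ≤ 1/2` the restriction on `k N` and the
inverse inequality give the bound (`mul_norm_midpoint_sq_le_of_cfl`). For `s > 1/2`, pairing the
equation with `i Y` bounds `k ‖(-∂ₓₓ)^{s/2} Y‖²`, and a Cauchy-Schwarz inequality with weight
`1 + κ |m|^{2s}`, where `κ = k |b|`, shows that `κ ‖Y‖²` tends to zero with `κ`
(`exists_mul_norm_midpoint_sq_le`). No uniqueness or existence of stages is needed.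
-/

open MeasureTheory

namespace FNLS

noncomputable section

/-! ### Fourier coefficients and multipliers -/

/-- The `m`-th Fourier coefficient as a continuous linear functional on the continuous functions. -/
def coeff (m : ℤ) : C(Circ, ℂ) →L[ℂ] ℂ :=
  LinearMap.mkContinuous
    { toFun := fun v => fourierCoeff v m
      map_add' := fun v w => by
        have hi : ∀ f : C(Circ, ℂ), Integrable f (AddCircle.haarAddCircle (T := 2 * Real.pi)) :=
          fun f => f.continuous.integrable_of_hasCompactSupport
            (HasCompactSupport.of_compactSpace _)
        have := congrFun (fourierCoeff.add (hi v) (hi w)) m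
        simpa using this
      map_smul' := fun c v => by
        simpa using fourierCoeff.const_smul (v : Circ → ℂ) c m }
    1 (fun v => by
      simp only [LinearMap.coe_mk, AddHom.coe_mk, one_mul, fourierCoeff]
      refine (norm_integral_le_of_norm_le_const (C := ‖v‖) (Filter.Eventually.of_forall ?_)).trans
        (by simp)
      intro x
      have h1 : ‖(fourier (-m) : C(Circ, ℂ)) x‖ = 1 := by
        rw [fourier_apply]; exact Circle.norm_coe _
      rw [norm_smul, h1, one_mul]
      exact v.norm_coe_le_norm x)

theorem coeff_apply (m : ℤ) (v : C(Circ, ℂ)) : coeff m v = fourierCoeff v m := rfl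

theorem coeff_fourier (m n : ℤ) :
    coeff m (fourier n : C(Circ, ℂ)) = if m = n then 1 else 0 := by
  rw [coeff_apply, fourierCoeff_fourier, Pi.single_apply]

/-- The frequencies `|m| ≤ N`. -/
def modes (N : ℕ) : Finset ℤ := Finset.Icc (-(N : ℤ)) (N : ℤ)

theorem mem_modes {N : ℕ} {m : ℤ} : m ∈ modes N ↔ |m| ≤ (N : ℤ) := by
  rw [modes, Finset.mem_Icc, abs_le]

theorem abs_le_of_mem_modes {N : ℕ} {m : ℤ} (h : m ∈ modes N) : |(m : ℝ)| ≤ N := by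
  have := mem_modes.1 h
  exact_mod_cast this

theorem card_modes (N : ℕ) : ((modes N).card : ℝ) = 2 * N + 1 := by
  have : (modes N).card = 2 * N + 1 := by
    rw [modes, Int.card_Icc]; omega
  rw [this]; push_cast; ring

/-- The Fourier multiplier with symbol `a`, restricted to the frequencies `|m| ≤ N`. -/
def mult (N : ℕ) (a : ℤ → ℂ) : C(Circ, ℂ) →L[ℂ] C(Circ, ℂ) :=
  ∑ m ∈ modes N, (a m • coeff m).smulRight (fourier m : C(Circ, ℂ))

theorem mult_apply (N : ℕ) (a : ℤ → ℂ) (v : C(Circ, ℂ)) :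
    mult N a v = ∑ m ∈ modes N, (a m * coeff m v) • (fourier m : C(Circ, ℂ)) := by
  simp [mult]

theorem coeff_mult (N : ℕ) (a : ℤ → ℂ) (v : C(Circ, ℂ)) (m : ℤ) :
    coeff m (mult N a v) = if m ∈ modes N then a m * coeff m v else 0 := by
  rw [mult_apply, map_sum]
  simp [map_smul, coeff_fourier]

theorem fourier_mem_trigPoly {N : ℕ} {m : ℤ} (hm : m ∈ modes N) :
    (fourier m : C(Circ, ℂ)) ∈ trigPoly N :=
  Submodule.subset_span ⟨m, mem_modes.1 hm, rfl⟩

theorem mult_mem (N : ℕ) (a : ℤ → ℂ) (v : C(Circ, ℂ)) : mult N a v ∈ trigPoly N := by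
  rw [mult_apply]
  exact Submodule.sum_mem _ fun m hm => Submodule.smul_mem _ _ (fourier_mem_trigPoly hm)

theorem proj_eq_mult (N : ℕ) (v : C(Circ, ℂ)) : proj N v = mult N 1 v := by
  simp [proj, mult_apply, modes, coeff_apply]

theorem mult_one_of_mem {N : ℕ} {v : C(Circ, ℂ)} (hv : v ∈ trigPoly N) : mult N 1 v = v := by
  induction hv using Submodule.span_induction with
  | mem x hx =>
    obtain ⟨m, hm, rfl⟩ := hx
    have hm' : m ∈ modes N := mem_modes.2 hm
    rw [mult_apply, Finset.sum_eq_single m]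
    · simp [coeff_fourier]
    · intro n _ hn; simp [coeff_fourier, hn]
    · intro h; exact absurd hm' h
  | zero => simp
  | add x y _ _ hx hy => rw [map_add, hx, hy]
  | smul c x _ hx => rw [map_smul, hx]

theorem eq_sum_of_mem {N : ℕ} {v : C(Circ, ℂ)} (hv : v ∈ trigPoly N) :
    v = ∑ m ∈ modes N, coeff m v • (fourier m : C(Circ, ℂ)) := by
  conv_lhs => rw [← mult_one_of_mem hv, mult_apply]
  simp

theorem coeff_eq_zero_of_mem {N : ℕ} {v : C(Circ, ℂ)} (hv : v ∈ trigPoly N) {m : ℤ}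
    (hm : m ∉ modes N) : coeff m v = 0 := by
  rw [← mult_one_of_mem hv, coeff_mult, if_neg hm]

theorem trigPoly_real_smul {N : ℕ} {v : C(Circ, ℂ)} (hv : v ∈ trigPoly N) (c : ℝ) :
    c • v ∈ trigPoly N := by
  have : c • v = (c : ℂ) • v := by ext x; simp
  rw [this]; exact Submodule.smul_mem _ _ hv

/-- The symbol `-i |m|^{2s}` of the linear part of the equation. -/
def linSymbol (s : ℝ) (m : ℤ) : ℂ := -(Complex.I * ((|(m : ℝ)| ^ (2 * s) : ℝ) : ℂ))

/-- The linear part `-i (-∂ₓₓ)^s` of the semidiscrete system. -/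
def linPart (s : ℝ) (N : ℕ) : C(Circ, ℂ) →L[ℂ] C(Circ, ℂ) := mult N (linSymbol s)

/-- The operator `i P_N`. -/
def iProj (N : ℕ) : C(Circ, ℂ) →L[ℂ] C(Circ, ℂ) := mult N (fun _ => Complex.I)

theorem fracLap_of_mem (s : ℝ) {N : ℕ} {v : C(Circ, ℂ)} (hv : v ∈ trigPoly N) :
    -(Complex.I • fracLap s v) = linPart s N v := by
  rw [fracLap, tsum_eq_sum (s := modes N), linPart, mult_apply, Finset.smul_sum,
    ← Finset.sum_neg_distrib]
  · refine Finset.sum_congr rfl fun m _ => ?_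
    rw [fracLapTerm, smul_smul, ← neg_smul, linSymbol, coeff_apply]
    congr 1; ring
  · intro m hm
    have := coeff_eq_zero_of_mem hv hm
    rw [coeff_apply] at this
    rw [fracLapTerm, this, mul_zero, zero_smul]

theorem cubic_eq (v : C(Circ, ℂ)) : cubic v = v * v * star v := by
  ext x
  simp only [cubic, ContinuousMap.coe_mk, ContinuousMap.coe_mul, ContinuousMap.coe_star,
    Pi.mul_apply, Pi.star_apply]
  have := Complex.mul_conj (v x)
  rw [Complex.normSq_eq_norm_sq] at this
  rw [mul_assoc, RCLike.star_def, this]; push_cast; ring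

theorem rhs_of_mem (s : ℝ) {N : ℕ} {v : C(Circ, ℂ)} (hv : v ∈ trigPoly N) :
    rhs s N v = linPart s N v + iProj N (v * v * star v) := by
  rw [rhs, fracLap_of_mem s hv, cubic_eq, proj_eq_mult, iProj, mult_apply, mult_apply,
    Finset.smul_sum]
  congr 1
  refine Finset.sum_congr rfl fun m _ => ?_
  rw [smul_smul]; simp

/-! ### The weighted Wiener norm -/

/-- The weighted `ℓ¹` norm `∑_{|m| ≤ N} (1 + |m|)^r |v̂_m|` of the low frequencies of `v`. -/
def wn (N r : ℕ) (v : C(Circ, ℂ)) : ℝ :=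
  ∑ m ∈ modes N, (1 + |(m : ℝ)|) ^ r * ‖coeff m v‖

theorem wn_nonneg (N r : ℕ) (v : C(Circ, ℂ)) : 0 ≤ wn N r v :=
  Finset.sum_nonneg fun m _ => by positivity

theorem wn_zero (N r : ℕ) : wn N r 0 = 0 := by simp [wn]

theorem wn_add_le (N r : ℕ) (v w : C(Circ, ℂ)) : wn N r (v + w) ≤ wn N r v + wn N r w := by
  rw [wn, wn, wn, ← Finset.sum_add_distrib]
  refine Finset.sum_le_sum fun m _ => ?_
  rw [← mul_add, map_add]
  gcongr
  exact norm_add_le _ _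

theorem wn_smul (N r : ℕ) (c : ℂ) (v : C(Circ, ℂ)) : wn N r (c • v) = ‖c‖ * wn N r v := by
  rw [wn, wn, Finset.mul_sum]
  refine Finset.sum_congr rfl fun m _ => ?_
  rw [map_smul, norm_smul]; ring

theorem wn_real_smul (N r : ℕ) (c : ℝ) (v : C(Circ, ℂ)) : wn N r (c • v) = |c| * wn N r v := by
  have : c • v = (c : ℂ) • v := by ext x; simp
  rw [this, wn_smul]; simp

theorem wn_sum_le {ι : Type*} (N r : ℕ) (t : Finset ι) (f : ι → C(Circ, ℂ)) :
    wn N r (∑ i ∈ t, f i) ≤ ∑ i ∈ t, wn N r (f i) :=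
  Finset.le_sum_of_subadditive _ (wn_zero N r).le (wn_add_le N r) t f

theorem wn_mono (N : ℕ) {r q : ℕ} (h : r ≤ q) (v : C(Circ, ℂ)) : wn N r v ≤ wn N q v := by
  refine Finset.sum_le_sum fun m _ => ?_
  gcongr
  linarith [abs_nonneg (m : ℝ)]

theorem wn_fourier_le (N r : ℕ) (n : ℤ) :
    wn N r (fourier n : C(Circ, ℂ)) ≤ (1 + |(n : ℝ)|) ^ r := by
  have h : ∀ m ∈ modes N, (1 + |(m : ℝ)|) ^ r * ‖coeff m (fourier n : C(Circ, ℂ))‖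
      = if m = n then (1 + |(n : ℝ)|) ^ r else 0 := by
    intro m _
    rw [coeff_fourier]
    split_ifs with h <;> simp [h]
  rw [wn, Finset.sum_congr rfl h, Finset.sum_ite_eq']
  split_ifs
  · exact le_rfl
  · positivity

theorem norm_le_wn {N : ℕ} {v : C(Circ, ℂ)} (hv : v ∈ trigPoly N) : ‖v‖ ≤ wn N 0 v := by
  conv_lhs => rw [eq_sum_of_mem hv]
  refine (norm_sum_le _ _).trans (Finset.sum_le_sum fun m _ => ?_)
  rw [norm_smul, fourier_norm]; simp

theorem wn_mult_le (N r q : ℕ) {a : ℤ → ℂ} (ha : ∀ m, ‖a m‖ ≤ (1 + |(m : ℝ)|) ^ q)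
    (v : C(Circ, ℂ)) : wn N r (mult N a v) ≤ wn N (r + q) v := by
  refine Finset.sum_le_sum fun m hm => ?_
  rw [coeff_mult, if_pos hm, norm_mul, pow_add, mul_assoc]
  gcongr
  exact ha m

theorem wn_iProj_le (N r : ℕ) (v : C(Circ, ℂ)) : wn N r (iProj N v) ≤ wn N r v :=
  wn_mult_le N r 0 (by simp) v

theorem norm_linSymbol (s : ℝ) (m : ℤ) : ‖linSymbol s m‖ = |(m : ℝ)| ^ (2 * s) := by
  rw [linSymbol, norm_neg, norm_mul, Complex.norm_I, one_mul, Complex.norm_real,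
    Real.norm_of_nonneg (Real.rpow_nonneg (abs_nonneg _) _)]

theorem wn_linPart_le {s : ℝ} (hs0 : 0 < s) (hs1 : s ≤ 1) (N r : ℕ) (v : C(Circ, ℂ)) :
    wn N r (linPart s N v) ≤ wn N (r + 2) v := by
  refine wn_mult_le N r 2 (fun m => ?_) v
  rw [norm_linSymbol]
  calc |(m : ℝ)| ^ (2 * s) ≤ (1 + |(m : ℝ)|) ^ (2 * s) :=
        Real.rpow_le_rpow (abs_nonneg _) (by linarith) (by linarith)
    _ ≤ (1 + |(m : ℝ)|) ^ (2 : ℝ) :=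
        Real.rpow_le_rpow_of_exponent_le (by linarith [abs_nonneg (m : ℝ)]) (by linarith)
    _ = _ := by norm_cast

/-- The weighted norm is submultiplicative because `1 + |a + b - c| ≤ (1+|a|)(1+|b|)(1+|c|)`. -/
theorem wn_mul_mul_star_le {N : ℕ} (r : ℕ) {u v w : C(Circ, ℂ)} (hu : u ∈ trigPoly N)
    (hv : v ∈ trigPoly N) (hw : w ∈ trigPoly N) :
    wn N r (u * v * star w) ≤ wn N r u * wn N r v * wn N r w := by
  have key : u * v * star w = ∑ a ∈ modes N, ∑ b ∈ modes N, ∑ c ∈ modes N,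
      (coeff a u * coeff b v * star (coeff c w)) • (fourier (a + b - c) : C(Circ, ℂ)) := by
    conv_lhs => rw [eq_sum_of_mem hu, eq_sum_of_mem hv, eq_sum_of_mem hw]
    rw [star_sum, Finset.sum_mul_sum, Finset.sum_mul]
    refine Finset.sum_congr rfl fun a _ => ?_
    rw [Finset.sum_mul_sum]
    refine Finset.sum_congr rfl fun b _ => Finset.sum_congr rfl fun c _ => ?_
    ext x
    simp only [ContinuousMap.coe_mul, ContinuousMap.coe_smul, ContinuousMap.coe_star,
      Pi.mul_apply, Pi.smul_apply, Pi.star_apply, smul_eq_mul, star_mul']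
    rw [sub_eq_add_neg, fourier_add, fourier_add, fourier_neg]
    simp only [RCLike.star_def]
    ring
  rw [key]
  have h3 : wn N r u * wn N r v * wn N r w = ∑ a ∈ modes N, ∑ b ∈ modes N, ∑ c ∈ modes N,
      ((1 + |(a : ℝ)|) ^ r * ‖coeff a u‖) * ((1 + |(b : ℝ)|) ^ r * ‖coeff b v‖) *
        ((1 + |(c : ℝ)|) ^ r * ‖coeff c w‖) := by
    rw [wn, wn, wn, Finset.sum_mul_sum, Finset.sum_mul]
    refine Finset.sum_congr rfl fun a _ => ?_
    rw [Finset.sum_mul_sum]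
  rw [h3]
  refine (wn_sum_le _ _ _ _).trans (Finset.sum_le_sum fun a _ => ?_)
  refine (wn_sum_le _ _ _ _).trans (Finset.sum_le_sum fun b _ => ?_)
  refine (wn_sum_le _ _ _ _).trans (Finset.sum_le_sum fun c _ => ?_)
  rw [wn_smul, norm_mul, norm_mul, norm_star]
  have h4 : (1 + |((a + b - c : ℤ) : ℝ)|) ^ r ≤
      (1 + |(a : ℝ)|) ^ r * (1 + |(b : ℝ)|) ^ r * (1 + |(c : ℝ)|) ^ r := by
    rw [← mul_pow, ← mul_pow]
    gcongr
    push_cast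
    have e1 := abs_sub ((a : ℝ) + b) c
    have e2 := abs_add_le (a : ℝ) b
    have p1 := mul_nonneg (abs_nonneg (a : ℝ)) (abs_nonneg (b : ℝ))
    have p2 := mul_nonneg (abs_nonneg (a : ℝ)) (abs_nonneg (c : ℝ))
    have p3 := mul_nonneg (abs_nonneg (b : ℝ)) (abs_nonneg (c : ℝ))
    have p4 := mul_nonneg p1 (abs_nonneg (c : ℝ))
    nlinarith
  calc ‖coeff a u‖ * ‖coeff b v‖ * ‖coeff c w‖ * wn N r (fourier (a + b - c) : C(Circ, ℂ))
      ≤ ‖coeff a u‖ * ‖coeff b v‖ * ‖coeff c w‖ *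
        ((1 + |(a : ℝ)|) ^ r * (1 + |(b : ℝ)|) ^ r * (1 + |(c : ℝ)|) ^ r) := by
        gcongr
        exact (wn_fourier_le N r _).trans h4
    _ = _ := by ring

/-! ### The `L²` inner product -/

/-- The embedding of the continuous functions into the real Hilbert space `L²(-π, π)`. -/
def toL2 : C(Circ, ℂ) →L[ℝ] Lp ℂ 2 (volume : Measure Circ) :=
  ContinuousMap.toLp 2 volume ℝ

theorem inner_toL2 (v w : C(Circ, ℂ)) :
    inner ℝ (toL2 v) (toL2 w) = ∫ x : Circ, (star (v x) * w x).re := by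
  rw [L2.inner_def]
  apply integral_congr_ae
  filter_upwards [ContinuousMap.coeFn_toLp (p := 2) (𝕜 := ℝ) (volume : Measure Circ) v,
    ContinuousMap.coeFn_toLp (p := 2) (𝕜 := ℝ) (volume : Measure Circ) w] with x h1 h2
  rw [toL2, h1, h2]
  simp only [Complex.inner, RCLike.star_def, mul_comm]

theorem norm_sq_toL2 (v : C(Circ, ℂ)) : ‖toL2 v‖ ^ 2 = ∫ x : Circ, ‖v x‖ ^ 2 := by
  rw [← real_inner_self_eq_norm_sq, inner_toL2]
  refine integral_congr_ae (Filter.Eventually.of_forall fun x => ?_)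
  have := Complex.normSq_eq_conj_mul_self (z := v x)
  simp only [RCLike.star_def]
  rw [← this, Complex.ofReal_re, Complex.normSq_eq_norm_sq]

theorem l2Norm_eq (v : C(Circ, ℂ)) : l2Norm v = ‖toL2 v‖ := by
  rw [l2Norm, ← norm_sq_toL2, Real.sqrt_sq (norm_nonneg _)]

theorem integrable_of_continuous {E : Type*} [NormedAddCommGroup E] {f : Circ → E}
    (hf : Continuous f) : Integrable f (volume : Measure Circ) :=
  hf.integrable_of_hasCompactSupport (HasCompactSupport.of_compactSpace _)

theorem norm_toL2_le_of_pointwise {v w : C(Circ, ℂ)} {c : ℝ} (hc : 0 ≤ c)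
    (h : ∀ x, ‖v x‖ ≤ c * ‖w x‖) : ‖toL2 v‖ ≤ c * ‖toL2 w‖ := by
  refine le_of_sq_le_sq ?_ (by positivity)
  rw [mul_pow, norm_sq_toL2, norm_sq_toL2, ← integral_const_mul]
  refine integral_mono (integrable_of_continuous (by fun_prop))
    (integrable_of_continuous (by fun_prop)) fun x => ?_
  simp only
  rw [← mul_pow]
  exact pow_le_pow_left₀ (norm_nonneg _) (h x) 2

theorem norm_toL2_one : ‖toL2 1‖ = Real.sqrt (2 * Real.pi) := by
  rw [← l2Norm_eq, l2Norm]
  congr 1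
  simp [Measure.real, AddCircle.measure_univ, Real.pi_pos.le]

theorem norm_toL2_le (v : C(Circ, ℂ)) : ‖toL2 v‖ ≤ Real.sqrt (2 * Real.pi) * ‖v‖ := by
  have h : ‖toL2 v‖ ≤ ‖v‖ * ‖toL2 1‖ := norm_toL2_le_of_pointwise (norm_nonneg _) fun x => by
    simpa using v.norm_coe_le_norm x
  rw [norm_toL2_one] at h
  exact h.trans_eq (mul_comm _ _)

theorem integral_fourier_mul (v : C(Circ, ℂ)) (m : ℤ) :
    ∫ x : Circ, star ((fourier m : C(Circ, ℂ)) x) * v x = (2 * Real.pi : ℝ) * coeff m v := by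
  rw [coeff_apply, fourierCoeff, AddCircle.integral_haarAddCircle, Complex.real_smul]
  rw [← mul_assoc, ← Complex.ofReal_mul, mul_inv_cancel₀ (by positivity), Complex.ofReal_one,
    one_mul]
  simp

/-- The inner product against a trigonometric polynomial sees only the frequencies `|m| ≤ N`. -/
theorem inner_of_mem {N : ℕ} {v : C(Circ, ℂ)} (hv : v ∈ trigPoly N) (w : C(Circ, ℂ)) :
    inner ℝ (toL2 v) (toL2 w) =
      2 * Real.pi * ∑ m ∈ modes N, (star (coeff m v) * coeff m w).re := by
  have h1 : ∫ x : Circ, star (v x) * w x =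
      ∑ m ∈ modes N, star (coeff m v) * ((2 * Real.pi : ℝ) * coeff m w) := by
    have h2 : ∀ x : Circ, star (v x) * w x = ∑ m ∈ modes N,
        star (coeff m v) * (star ((fourier m : C(Circ, ℂ)) x) * w x) := by
      intro x
      conv_lhs => rw [eq_sum_of_mem hv]
      rw [ContinuousMap.coe_sum, Finset.sum_apply, star_sum, Finset.sum_mul]
      refine Finset.sum_congr rfl fun m _ => ?_
      simp [mul_assoc]
    simp_rw [h2]
    rw [integral_finsetSum _ fun m _ => integrable_of_continuous (by fun_prop)]
    refine Finset.sum_congr rfl fun m _ => ?_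
    rw [integral_const_mul, integral_fourier_mul]
  rw [inner_toL2]
  have h3 := integral_re (𝕜 := ℂ) (f := fun x : Circ => star (v x) * w x) (μ := volume)
    (integrable_of_continuous (by fun_prop))
  simp only [RCLike.re_eq_complex_re] at h3
  rw [h3, h1, Complex.re_sum, Finset.mul_sum]
  refine Finset.sum_congr rfl fun m _ => ?_
  rw [mul_left_comm, Complex.re_ofReal_mul]

theorem norm_sq_of_mem {N : ℕ} {v : C(Circ, ℂ)} (hv : v ∈ trigPoly N) :
    ‖toL2 v‖ ^ 2 = 2 * Real.pi * ∑ m ∈ modes N, ‖coeff m v‖ ^ 2 := by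
  rw [← real_inner_self_eq_norm_sq, inner_of_mem hv]
  congr 1
  refine Finset.sum_congr rfl fun m _ => ?_
  rw [RCLike.star_def, ← Complex.normSq_eq_conj_mul_self, Complex.ofReal_re,
    Complex.normSq_eq_norm_sq]

theorem inner_mult {N : ℕ} {v : C(Circ, ℂ)} (hv : v ∈ trigPoly N) (a : ℤ → ℂ)
    (w : C(Circ, ℂ)) :
    inner ℝ (toL2 v) (toL2 (mult N a w)) =
      2 * Real.pi * ∑ m ∈ modes N, (star (coeff m v) * (a m * coeff m w)).re := by
  rw [inner_of_mem hv]
  congr 1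
  refine Finset.sum_congr rfl fun m hm => ?_
  rw [coeff_mult, if_pos hm]

theorem inner_iProj {N : ℕ} {v : C(Circ, ℂ)} (hv : v ∈ trigPoly N) (w : C(Circ, ℂ)) :
    inner ℝ (toL2 v) (toL2 (iProj N w)) = inner ℝ (toL2 v) (toL2 (Complex.I • w)) := by
  rw [iProj, inner_mult hv, inner_of_mem hv]
  simp

theorem inner_linPart (s : ℝ) {N : ℕ} {v : C(Circ, ℂ)} (hv : v ∈ trigPoly N) :
    inner ℝ (toL2 v) (toL2 (linPart s N v)) = 0 := by
  rw [linPart, inner_mult hv, Finset.sum_eq_zero, mul_zero]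
  intro m _
  have : star (coeff m v) * (linSymbol s m * coeff m v) =
      linSymbol s m * (star (coeff m v) * coeff m v) := by ring
  rw [this, RCLike.star_def, ← Complex.normSq_eq_conj_mul_self, linSymbol]
  simp

theorem inner_I_cubic (v : C(Circ, ℂ)) :
    inner ℝ (toL2 v) (toL2 (Complex.I • (v * v * star v))) = 0 := by
  rw [inner_toL2]
  have : ∀ x : Circ, (star (v x) * (Complex.I • (v * v * star v)) x).re = 0 := by
    intro x
    have h : star (v x) * (Complex.I • (v * v * star v)) x =
        Complex.I * ((star (v x) * v x) * (star (v x) * v x)) := by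
      simp; ring
    rw [h, RCLike.star_def, ← Complex.normSq_eq_conj_mul_self]
    simp [← Complex.ofReal_mul]
  simp_rw [this, integral_zero]

theorem inner_rhs {s : ℝ} {N : ℕ} {v : C(Circ, ℂ)} (hv : v ∈ trigPoly N) :
    inner ℝ (toL2 v) (toL2 (rhs s N v)) = 0 := by
  rw [rhs_of_mem s hv, map_add, inner_add_right, inner_linPart s hv, inner_iProj hv,
    inner_I_cubic, add_zero]

/-! ### Estimates for the cubic nonlinearity -/

theorem norm_cubic_sub_le (z w : ℂ) :
    ‖z * z * star z - w * w * star w‖ ≤ 3 / 2 * (‖z‖ ^ 2 + ‖w‖ ^ 2) * ‖z - w‖ := by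
  have h : z * z * star z - w * w * star w =
      (z - w) * (z * star z) + w * ((z - w) * star z) + w * w * star (z - w) := by
    rw [star_sub]; ring
  rw [h]
  refine (norm_add₃_le).trans ?_
  simp only [norm_mul, norm_star]
  nlinarith [norm_nonneg (z - w), mul_nonneg (norm_nonneg (z - w)) (sq_nonneg (‖z‖ - ‖w‖))]

theorem norm_cubic_sub_toL2_le (v w : C(Circ, ℂ)) :
    ‖toL2 (Complex.I • (v * v * star v - w * w * star w))‖ ≤
      3 / 2 * (‖v‖ ^ 2 + ‖w‖ ^ 2) * ‖toL2 (v - w)‖ := by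
  refine norm_toL2_le_of_pointwise (by positivity) fun x => ?_
  have h1 := norm_cubic_sub_le (v x) (w x)
  have h2 := v.norm_coe_le_norm x
  have h3 := w.norm_coe_le_norm x
  simp only [ContinuousMap.coe_smul, ContinuousMap.coe_sub, ContinuousMap.coe_mul,
    ContinuousMap.coe_star, Pi.smul_apply, Pi.sub_apply, Pi.mul_apply, Pi.star_apply, norm_smul,
    Complex.norm_I, one_mul]
  refine h1.trans ?_
  gcongr

/-- One-sided Lipschitz estimate: the linear part is skew and drops out, and the projection is
absorbed into the test function, so that no derivative is lost. -/
theorem inner_rhs_sub_le (s : ℝ) {N : ℕ} {v w : C(Circ, ℂ)} (hv : v ∈ trigPoly N)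
    (hw : w ∈ trigPoly N) :
    |inner ℝ (toL2 (v - w)) (toL2 (rhs s N v - rhs s N w))| ≤
      3 / 2 * (‖v‖ ^ 2 + ‖w‖ ^ 2) * ‖toL2 (v - w)‖ ^ 2 := by
  have hvw : v - w ∈ trigPoly N := Submodule.sub_mem _ hv hw
  have h : rhs s N v - rhs s N w =
      linPart s N (v - w) + iProj N (v * v * star v - w * w * star w) := by
    rw [rhs_of_mem s hv, rhs_of_mem s hw, map_sub, map_sub]; abel
  rw [h, map_add, inner_add_right, inner_linPart s hvw, inner_iProj hvw, zero_add]
  refine (abs_real_inner_le_norm _ _).trans ?_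
  have := norm_cubic_sub_toL2_le v w
  calc _ ≤ ‖toL2 (v - w)‖ * (3 / 2 * (‖v‖ ^ 2 + ‖w‖ ^ 2) * ‖toL2 (v - w)‖) := by gcongr
    _ = _ := by ring

/-! ### Inverse inequalities -/

theorem wn_le_norm_toL2 {N : ℕ} (r : ℕ) {v : C(Circ, ℂ)} (hv : v ∈ trigPoly N) :
    wn N r v ≤ (1 + N : ℝ) ^ r * Real.sqrt ((2 * N + 1) / (2 * Real.pi)) * ‖toL2 v‖ := by
  have h1 : wn N r v ≤ (1 + N : ℝ) ^ r * ∑ m ∈ modes N, ‖coeff m v‖ := by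
    rw [Finset.mul_sum]
    refine Finset.sum_le_sum fun m hm => ?_
    gcongr
    exact abs_le_of_mem_modes hm
  have h2 : ∑ m ∈ modes N, ‖coeff m v‖ ≤
      Real.sqrt ((2 * N + 1) / (2 * Real.pi)) * ‖toL2 v‖ := by
    refine le_of_sq_le_sq ?_ (by positivity)
    rw [mul_pow, Real.sq_sqrt (by positivity), norm_sq_of_mem hv]
    refine (sq_sum_le_card_mul_sum_sq).trans (le_of_eq ?_)
    rw [card_modes]
    field_simp
  rw [mul_assoc]
  exact h1.trans (by gcongr)

theorem norm_sq_le_of_mem {N : ℕ} {v : C(Circ, ℂ)} (hv : v ∈ trigPoly N) :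
    ‖v‖ ^ 2 ≤ (2 * N + 1) / (2 * Real.pi) * ‖toL2 v‖ ^ 2 := by
  have h := (norm_le_wn hv).trans (wn_le_norm_toL2 0 hv)
  rw [pow_zero, one_mul] at h
  calc ‖v‖ ^ 2 ≤ (Real.sqrt ((2 * N + 1) / (2 * Real.pi)) * ‖toL2 v‖) ^ 2 := by gcongr
    _ = _ := by rw [mul_pow, Real.sq_sqrt (by positivity)]

/-! ### Energy estimates -/

/-- If `⟨e, e'⟩ < κ ‖e‖²` holds as long as `‖e‖` is between `η` and the final value of
`η exp (κ (t - a))`, then `‖e‖` never exceeds `η exp (κ (t - a))`. The upper restriction is what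
makes a separate continuation argument unnecessary. -/
theorem norm_toL2_le_exp {e e' : ℝ → C(Circ, ℂ)} {a b η κ : ℝ} (hη : 0 < η) (hκ : 0 ≤ κ)
    (he : ∀ t ∈ Set.Icc a b, HasDerivWithinAt e (e' t) (Set.Icc a b) t)
    (ha : ‖toL2 (e a)‖ ≤ η)
    (hb : ∀ t ∈ Set.Icc a b, η ≤ ‖toL2 (e t)‖ → ‖toL2 (e t)‖ ≤ η * Real.exp (κ * (b - a)) →
      inner ℝ (toL2 (e t)) (toL2 (e' t)) < κ * ‖toL2 (e t)‖ ^ 2) :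
    ∀ t ∈ Set.Icc a b, ‖toL2 (e t)‖ ≤ η * Real.exp (κ * (t - a)) := by
  have hd : ∀ t ∈ Set.Icc a b, HasDerivWithinAt (fun t => ‖toL2 (e t)‖ ^ 2)
      (2 * inner ℝ (toL2 (e t)) (toL2 (e' t))) (Set.Icc a b) t := fun t ht =>
    (toL2.hasFDerivAt.comp_hasDerivWithinAt t (he t ht)).norm_sq
  have hB : ∀ t, HasDerivAt (fun t => (η * Real.exp (κ * (t - a))) ^ 2)
      (2 * κ * (η * Real.exp (κ * (t - a))) ^ 2) t := by
    intro t
    have h1 : HasDerivAt (fun t => κ * (t - a)) κ t := by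
      simpa using ((hasDerivAt_id t).sub_const a).const_mul κ
    have h2 := ((h1.exp).const_mul η).pow 2
    refine h2.congr_deriv ?_
    push_cast
    ring
  have key := image_le_of_deriv_right_lt_deriv_boundary' (f := fun t => ‖toL2 (e t)‖ ^ 2)
    (f' := fun t => 2 * inner ℝ (toL2 (e t)) (toL2 (e' t))) (a := a) (b := b)
    (B := fun t => (η * Real.exp (κ * (t - a))) ^ 2)
    (B' := fun t => 2 * κ * (η * Real.exp (κ * (t - a))) ^ 2)
    (fun t ht => (hd t ht).continuousWithinAt)
    (fun t ht => (hd t ⟨ht.1, ht.2.le⟩).mono_of_mem_nhdsWithin (Icc_mem_nhdsGE_of_mem ht))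
    (by simp; exact pow_le_pow_left₀ (norm_nonneg _) ha 2)
    (fun t _ => (hB t).continuousAt.continuousWithinAt)
    (fun t _ => (hB t).hasDerivWithinAt) ?_
  · intro t ht
    exact le_of_sq_le_sq (key ht) (by positivity)
  · intro t ht heq
    have heq' : ‖toL2 (e t)‖ = η * Real.exp (κ * (t - a)) :=
      (pow_left_inj₀ (norm_nonneg _) (by positivity) two_ne_zero).1 heq
    have h1 := hb t ⟨ht.1, ht.2.le⟩
      (by rw [heq']; exact le_mul_of_one_le_right hη.le
            (Real.one_le_exp (mul_nonneg hκ (by linarith [ht.1]))))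
      (by rw [heq']; gcongr; exact ht.2.le)
    rw [← heq]
    linarith

theorem norm_toL2_const {s T : ℝ} {N : ℕ} {u₀ : C(Circ, ℂ)} {uN : ℝ → C(Circ, ℂ)}
    (h : IsSemidiscrete s N T u₀ uN) :
    ∀ t ∈ Set.Icc 0 T, ‖toL2 (uN t)‖ = ‖toL2 (proj N u₀)‖ := by
  intro t ht
  have hd : ∀ t ∈ Set.Icc 0 T, HasDerivWithinAt (fun t => ‖toL2 (uN t)‖ ^ 2)
      0 (Set.Icc 0 T) t := fun t ht => by
    have := (toL2.hasFDerivAt.comp_hasDerivWithinAt t (h.hasDeriv t ht)).norm_sq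
    rwa [Function.comp_apply, inner_rhs (h.mem t ht), mul_zero] at this
  have key := constant_of_has_deriv_right_zero (f := fun t => ‖toL2 (uN t)‖ ^ 2)
    (fun t ht => (hd t ht).continuousWithinAt)
    (fun t ht => (hd t ⟨ht.1, ht.2.le⟩).mono_of_mem_nhdsWithin (Icc_mem_nhdsGE_of_mem ht)) t ht
  simp only [h.initial] at key
  exact (pow_left_inj₀ (norm_nonneg _) (norm_nonneg _) two_ne_zero).1 key

/-! ### Bounds on the semidiscrete solution, uniform in `N` -/

theorem summable_one_div_one_add_sq : Summable fun m : ℤ => 1 / (1 + (m : ℝ) ^ 2) := by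
  refine Summable.of_norm_bounded_eventually
    (Real.summable_one_div_int_pow (p := 2) |>.2 one_lt_two) ?_
  rw [Filter.eventually_cofinite]
  refine (Set.finite_singleton (0 : ℤ)).subset fun m hm => ?_
  by_contra h0
  refine hm ?_
  have h1 : (0 : ℝ) < (m : ℝ) ^ 2 := by
    have : (m : ℝ) ≠ 0 := by exact_mod_cast h0
    positivity
  rw [Real.norm_of_nonneg (by positivity)]
  exact one_div_le_one_div_of_le h1 (by linarith)

/-- Cauchy-Schwarz: the weights `(1 + |m|)^{22} / (1 + m²)^{12}` are summable. -/
theorem wn_le_sobolevNorm {μ : ℝ} (hμ : 12 ≤ μ) {v : C(Circ, ℂ)} (hv : MemSobolev μ v) (N : ℕ) :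
    wn N 11 v ≤
      Real.sqrt (2 ^ 11 * ∑' m : ℤ, 1 / (1 + (m : ℝ) ^ 2)) * sobolevNorm μ v := by
  have hS : 0 ≤ ∑' m : ℤ, 1 / (1 + (m : ℝ) ^ 2) := tsum_nonneg fun m => by positivity
  have h1 : ∀ m : ℤ, (1 + |(m : ℝ)|) ^ 11 * ‖coeff m v‖ ≤
      (Real.sqrt (2 ^ 11 * (1 / (1 + (m : ℝ) ^ 2)))) *
        Real.sqrt ((1 + (m : ℝ) ^ 2) ^ μ * ‖fourierCoeff v m‖ ^ 2) := by
    intro m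
    have hp : (0 : ℝ) < 1 + (m : ℝ) ^ 2 := by positivity
    rw [← Real.sqrt_mul (by positivity)]
    refine Real.le_sqrt_of_sq_le ?_
    rw [mul_pow, ← coeff_apply, ← mul_assoc]
    gcongr
    have h2 : (1 + |(m : ℝ)|) ^ 2 ≤ 2 * (1 + (m : ℝ) ^ 2) := by
      have := sq_abs (m : ℝ)
      nlinarith [sq_nonneg (1 - |(m : ℝ)|)]
    have h3 : (1 + (m : ℝ) ^ 2) ^ (12 : ℕ) ≤ (1 + (m : ℝ) ^ 2) ^ μ := by
      rw [← Real.rpow_natCast]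
      exact Real.rpow_le_rpow_of_exponent_le (by nlinarith [sq_nonneg (m : ℝ)])
        (by exact_mod_cast hμ)
    calc ((1 + |(m : ℝ)|) ^ 11) ^ 2 = ((1 + |(m : ℝ)|) ^ 2) ^ 11 := by ring
      _ ≤ (2 * (1 + (m : ℝ) ^ 2)) ^ 11 := by gcongr
      _ = 2 ^ 11 * (1 / (1 + (m : ℝ) ^ 2)) * (1 + (m : ℝ) ^ 2) ^ (12 : ℕ) := by
        field_simp
      _ ≤ _ := by gcongr
  have h2 := (Finset.sum_le_sum fun m (_ : m ∈ modes N) => h1 m).trans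
    (Real.sum_mul_le_sqrt_mul_sqrt _ _ _)
  refine h2.trans ?_
  rw [sobolevNorm]
  gcongr
  · rw [← tsum_mul_left]
    refine (le_of_eq (Finset.sum_congr rfl fun m _ => Real.sq_sqrt (by positivity))).trans ?_
    exact (summable_one_div_one_add_sq.mul_left _).sum_le_tsum _ fun m _ => by positivity
  · refine (le_of_eq (Finset.sum_congr rfl fun m _ => Real.sq_sqrt (by positivity))).trans ?_
    exact hv.sum_le_tsum _ fun m _ => by positivity

theorem tendsto_modes : Filter.Tendsto modes Filter.atTop Filter.atTop :=
  Finset.tendsto_Icc_neg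

theorem exists_subset_modes (t : Finset ℤ) : ∃ N : ℕ, t ⊆ modes N :=
  (tendsto_modes.eventually_ge_atTop t).exists

theorem modes_mono : Monotone modes := fun M N h m hm => by
  rw [mem_modes] at *
  omega

theorem tendsto_proj {v : C(Circ, ℂ)} {A : ℝ} (hA : ∀ N, wn N 11 v ≤ A) :
    Filter.Tendsto (fun N => proj N v) Filter.atTop (nhds v) := by
  have hs : Summable (fourierCoeff v) := by
    refine Summable.of_norm (summable_of_sum_le (c := A) (fun _ => norm_nonneg _) fun t => ?_)
    obtain ⟨N, hN⟩ := exists_subset_modes t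
    refine (Finset.sum_le_sum_of_subset_of_nonneg hN fun _ _ _ => norm_nonneg _).trans
      (le_trans ?_ ((wn_mono N (Nat.zero_le 11) v).trans (hA N)))
    simp [wn, coeff_apply]
  exact (hasSum_fourier_series_of_summable hs).comp tendsto_modes

theorem norm_proj_le {v : C(Circ, ℂ)} {A : ℝ} (hA : ∀ N, wn N 11 v ≤ A) (N : ℕ) :
    ‖proj N v‖ ≤ A := by
  rw [proj_eq_mult]
  refine (norm_le_wn (mult_mem _ _ _)).trans ?_
  exact (wn_mult_le N 0 0 (by simp) v).trans ((wn_mono N (Nat.zero_le 11) v).trans (hA N))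

theorem norm_le_of_wn_le {v : C(Circ, ℂ)} {A : ℝ} (hA : ∀ N, wn N 11 v ≤ A) : ‖v‖ ≤ A :=
  le_of_tendsto (tendsto_proj hA).norm (Filter.Eventually.of_forall (norm_proj_le hA))

theorem norm_sub_proj_le {v : C(Circ, ℂ)} {A : ℝ} (hA : ∀ N, wn N 11 v ≤ A) (N : ℕ) :
    ‖v - proj N v‖ ≤ A / (1 + N) ^ 11 := by
  refine le_of_tendsto ((tendsto_proj hA).sub_const (proj N v)).norm ?_
  filter_upwards [Filter.eventually_ge_atTop N] with M hM
  have h1 : proj M v - proj N v =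
      ∑ m ∈ modes M \ modes N, coeff m v • (fourier m : C(Circ, ℂ)) := by
    rw [sub_eq_iff_eq_add]
    exact (Finset.sum_sdiff (modes_mono hM)).symm
  rw [h1, le_div_iff₀ (by positivity)]
  refine le_trans ?_ (hA M)
  have h2 : ‖∑ m ∈ modes M \ modes N, coeff m v • (fourier m : C(Circ, ℂ))‖ ≤
      ∑ m ∈ modes M \ modes N, ‖coeff m v‖ := by
    refine (norm_sum_le _ _).trans (le_of_eq (Finset.sum_congr rfl fun m _ => ?_))
    rw [norm_smul, fourier_norm, mul_one]
  calc _ ≤ (∑ m ∈ modes M \ modes N, ‖coeff m v‖) * (1 + N : ℝ) ^ 11 := by gcongr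
    _ ≤ ∑ m ∈ modes M \ modes N, (1 + |(m : ℝ)|) ^ 11 * ‖coeff m v‖ := by
      rw [Finset.sum_mul]
      refine Finset.sum_le_sum fun m hm => ?_
      rw [mul_comm]
      have h3 : (N : ℝ) ≤ |(m : ℝ)| := by
        have h4 := (Finset.mem_sdiff.1 hm).2
        rw [mem_modes, not_le] at h4
        exact_mod_cast h4.le
      gcongr
    _ ≤ _ := Finset.sum_le_sum_of_subset_of_nonneg Finset.sdiff_subset
      fun _ _ _ => by positivity

theorem coeff_fracLap {s : ℝ} {v : C(Circ, ℂ)} (hv : Summable (fracLapTerm s v)) (m : ℤ) :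
    coeff m (fracLap s v) = ((|(m : ℝ)| ^ (2 * s) : ℝ) : ℂ) * coeff m v := by
  rw [fracLap, (coeff m).map_tsum hv, tsum_eq_single m]
  · rw [fracLapTerm, map_smul, coeff_fourier, if_pos rfl, smul_eq_mul, mul_one, coeff_apply]
  · intro n hn
    rw [fracLapTerm, map_smul, coeff_fourier, if_neg hn.symm, smul_zero]

theorem ext_coeff {N : ℕ} {v w : C(Circ, ℂ)} (hv : v ∈ trigPoly N) (hw : w ∈ trigPoly N)
    (h : ∀ m ∈ modes N, coeff m v = coeff m w) : v = w := by
  rw [eq_sum_of_mem hv, eq_sum_of_mem hw]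
  exact Finset.sum_congr rfl fun m hm => by rw [h m hm]

theorem linPart_mult_one (s : ℝ) (N : ℕ) (v : C(Circ, ℂ)) :
    linPart s N (mult N 1 v) = linPart s N v := by
  refine ext_coeff (mult_mem _ _ _) (mult_mem _ _ _) fun m hm => ?_
  simp [linPart, coeff_mult, hm]

theorem sqrt_card_le (N : ℕ) : Real.sqrt ((2 * N + 1) / (2 * Real.pi)) ≤ 1 + N := by
  have h : (2 * (N : ℝ) + 1) / (2 * Real.pi) ≤ 1 + N := by
    rw [div_le_iff₀ (by positivity)]
    nlinarith [Real.pi_gt_three, (Nat.cast_nonneg N : (0 : ℝ) ≤ N)]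
  refine Real.sqrt_le_iff.2 ⟨by positivity, h.trans ?_⟩
  nlinarith [(Nat.cast_nonneg N : (0 : ℝ) ≤ N)]

theorem sqrt_two_pi_le : Real.sqrt (2 * Real.pi) ≤ 3 :=
  Real.sqrt_le_iff.2 ⟨by norm_num, by nlinarith [Real.pi_lt_four]⟩

/-- The error equation for the difference of the semidiscrete solution and the truncation
of the exact one. -/
theorem hasDerivWithinAt_sub_proj {s T : ℝ} {u uN : ℝ → C(Circ, ℂ)} {N : ℕ}
    (hu : IsSolution s T u) (hN : IsSemidiscrete s N T (u 0) uN) {t : ℝ}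
    (ht : t ∈ Set.Icc 0 T) :
    HasDerivWithinAt (fun t => uN t - proj N (u t))
      (linPart s N (uN t - proj N (u t)) +
        iProj N (uN t * uN t * star (uN t) - u t * u t * star (u t))) (Set.Icc 0 T) t := by
  have h1 : HasDerivWithinAt (fun t => proj N (u t))
      (mult N 1 (-(Complex.I • fracLap s (u t)) + Complex.I • cubic (u t))) (Set.Icc 0 T) t := by
    have : (fun t => proj N (u t)) = fun t => ((mult N 1).restrictScalars ℝ) (u t) := by
      ext1 t; exact proj_eq_mult N (u t)
    rw [this]
    exact ((mult N 1).restrictScalars ℝ).hasFDerivAt.comp_hasDerivWithinAt t (hu.hasDeriv t ht)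
  refine ((hN.hasDeriv t ht).sub h1).congr_deriv ?_
  rw [rhs_of_mem s (hN.mem t ht), proj_eq_mult, cubic_eq]
  have h2 : mult N 1 (-(Complex.I • fracLap s (u t)) + Complex.I • (u t * u t * star (u t))) =
      linPart s N (u t) + iProj N (u t * u t * star (u t)) := by
    refine ext_coeff (mult_mem _ _ _)
      (Submodule.add_mem _ (mult_mem _ _ _) (mult_mem _ _ _)) fun m hm => ?_
    rw [coeff_mult, if_pos hm, map_add, map_add, linPart, iProj, coeff_mult, coeff_mult,
      if_pos hm, if_pos hm, map_neg, map_smul, map_smul, coeff_fracLap (hu.summable_fracLap t ht),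
      linSymbol]
    simp only [Pi.one_apply, smul_eq_mul]
    ring
  rw [h2, map_sub, map_sub, linPart_mult_one]
  abel

/-- Comparison with the truncated exact solution: for large `N` the `L²` error is so small that
the inverse inequality still bounds it in the weighted norm. -/
theorem norm_toL2_sub_proj_le {s T A : ℝ} (hT : 0 ≤ T) {u uN : ℝ → C(Circ, ℂ)} {N : ℕ}
    (hu : IsSolution s T u) (hA : ∀ t ∈ Set.Icc 0 T, ∀ N, wn N 11 (u t) ≤ A)
    (hN : IsSemidiscrete s N T (u 0) uN)
    (hlarge : ((A + 1) * Real.exp ((12 * (1 + A) ^ 2 + 1) * T)) ^ 2 ≤ 1 + N) :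
    ∀ t ∈ Set.Icc 0 T, ‖toL2 (uN t - proj N (u t))‖ ≤
      (A + 1) * Real.exp ((12 * (1 + A) ^ 2 + 1) * T) / (1 + N) ^ 11 := by
  have hA0 : 0 ≤ A := (wn_nonneg 0 11 _).trans (hA 0 ⟨le_rfl, hT⟩ 0)
  -- Four times the Lipschitz constant `3 (1 + A)²` of the cubic term: as long as `‖e‖ ≥ η`, the
  -- truncation error adds at most `3 ‖e‖` to `‖e‖`.
  set κ : ℝ := 12 * (1 + A) ^ 2 + 1 with hκ
  have hκ0 : 0 ≤ κ := by positivity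
  set η : ℝ := (A + 1) / (1 + N) ^ 11 with hη
  have hη0 : 0 < η := by positivity
  have key := norm_toL2_le_exp (e := fun t => uN t - proj N (u t)) hη0 hκ0
    (fun t ht => hasDerivWithinAt_sub_proj hu hN ht)
    (by simp [hN.initial, hη0.le]) ?_
  · intro t ht
    refine (key t ht).trans ?_
    rw [hη, div_mul_eq_mul_div]
    gcongr
    linarith [ht.2]
  · intro t ht h1 h2
    simp only [sub_zero] at h2 ⊢
    have hpm : proj N (u t) ∈ trigPoly N := by rw [proj_eq_mult]; exact mult_mem _ _ _
    have hem : uN t - proj N (u t) ∈ trigPoly N := Submodule.sub_mem _ (hN.mem t ht) hpm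
    set e := uN t - proj N (u t) with he
    have hsup : ‖e‖ ≤ 1 := by
      have h3 := norm_sq_le_of_mem hem
      have h4 : (2 * (N : ℝ) + 1) / (2 * Real.pi) ≤ 1 + N := by
        rw [div_le_iff₀ (by positivity)]
        nlinarith [Real.pi_gt_three, (Nat.cast_nonneg N : (0 : ℝ) ≤ N)]
      have h5 : ‖toL2 e‖ ^ 2 ≤ 1 / (1 + N) ^ 21 := by
        calc ‖toL2 e‖ ^ 2 ≤ (η * Real.exp (κ * T)) ^ 2 := by gcongr
          _ = ((A + 1) * Real.exp (κ * T)) ^ 2 / (1 + N) ^ 22 := by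
            rw [hη, div_mul_eq_mul_div, div_pow, ← pow_mul]
          _ ≤ (1 + N) / (1 + N) ^ 22 := by gcongr
          _ = 1 / (1 + N) ^ 21 := by field_simp
      have h6 : ‖e‖ ^ 2 ≤ 1 := by
        calc ‖e‖ ^ 2 ≤ (1 + N) * (1 / (1 + N) ^ 21) := h3.trans (by gcongr)
          _ = 1 / (1 + N) ^ 20 := by field_simp
          _ ≤ 1 := div_le_one_of_le₀ (one_le_pow₀ (by simp)) (by positivity)
      nlinarith [norm_nonneg e]
    have hU : ‖uN t‖ ≤ 1 + A := by
      have : uN t = e + proj N (u t) := by rw [he]; abel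
      rw [this]
      exact (norm_add_le _ _).trans (add_le_add hsup (norm_proj_le (hA t ht) N))
    have hu' : ‖u t‖ ≤ 1 + A := (norm_le_of_wn_le (hA t ht)).trans (by linarith)
    have hd : ‖toL2 (uN t - u t)‖ ≤ 4 * ‖toL2 e‖ := by
      have h3 : uN t - u t = e - (u t - proj N (u t)) := by rw [he]; abel
      have h4 : ‖toL2 (u t - proj N (u t))‖ ≤ 3 * η := by
        refine (norm_toL2_le _).trans ?_
        have h5 : ‖u t - proj N (u t)‖ ≤ η :=
          (norm_sub_proj_le (hA t ht) N).trans (by rw [hη]; gcongr; linarith)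
        exact mul_le_mul sqrt_two_pi_le h5 (norm_nonneg _) (by norm_num)
      rw [h3, map_sub]
      refine (norm_sub_le _ _).trans ?_
      linarith
    rw [map_add, inner_add_right, inner_linPart s hem, inner_iProj hem, zero_add]
    have hL := norm_cubic_sub_toL2_le (uN t) (u t)
    have he0 : 0 < ‖toL2 e‖ := hη0.trans_le h1
    calc _ ≤ ‖toL2 e‖ * ‖toL2 (Complex.I • (uN t * uN t * star (uN t) - u t * u t * star (u t)))‖ :=
          real_inner_le_norm _ _
      _ ≤ ‖toL2 e‖ * (3 / 2 * ((1 + A) ^ 2 + (1 + A) ^ 2) * (4 * ‖toL2 e‖)) := by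
          gcongr
          refine hL.trans ?_
          gcongr
      _ = (κ - 1) * ‖toL2 e‖ ^ 2 := by rw [hκ]; ring
      _ < κ * ‖toL2 e‖ ^ 2 := by nlinarith [sq_pos_of_pos he0]

/-- The semidiscrete solutions inherit the regularity of the exact solution, uniformly in `N`. -/
theorem exists_wn_le {s T μ B : ℝ} (hT : 0 ≤ T) (hμ : 12 ≤ μ) {u : ℝ → C(Circ, ℂ)}
    (hu : IsSolution s T u) (hm : ∀ t ∈ Set.Icc 0 T, MemSobolev μ (u t))
    (hB : ∀ t ∈ Set.Icc 0 T, sobolevNorm μ (u t) ≤ B) :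
    ∃ K : ℝ, 0 ≤ K ∧ ∀ (N : ℕ) (uN : ℝ → C(Circ, ℂ)), IsSemidiscrete s N T (u 0) uN →
      ∀ t ∈ Set.Icc 0 T, wn N 10 (uN t) ≤ K := by
  set A : ℝ := Real.sqrt (2 ^ 11 * ∑' m : ℤ, 1 / (1 + (m : ℝ) ^ 2)) * B with hAdef
  have hA : ∀ t ∈ Set.Icc 0 T, ∀ N, wn N 11 (u t) ≤ A := fun t ht N =>
    (wn_le_sobolevNorm hμ (hm t ht) N).trans (by rw [hAdef]; gcongr; exact hB t ht)
  have h0 : (0 : ℝ) ∈ Set.Icc 0 T := ⟨le_rfl, hT⟩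
  have hA0 : 0 ≤ A := (wn_nonneg 0 11 _).trans (hA 0 h0 0)
  set Q : ℝ := (A + 1) * Real.exp ((12 * (1 + A) ^ 2 + 1) * T) with hQ
  have hQ0 : 0 ≤ Q := by positivity
  refine ⟨Q + A + (Q ^ 2) ^ 11 * (3 * A), by positivity, fun N uN hN t ht => ?_⟩
  have hpos : 0 ≤ (Q ^ 2) ^ 11 * (3 * A) := by positivity
  rcases le_or_gt (Q ^ 2) (1 + N) with hl | hl
  · have h1 := norm_toL2_sub_proj_le hT hu hA hN hl t ht
    have hpm : proj N (u t) ∈ trigPoly N := by rw [proj_eq_mult]; exact mult_mem _ _ _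
    have h2 := wn_le_norm_toL2 10 (Submodule.sub_mem _ (hN.mem t ht) hpm)
    have h3 : wn N 10 (uN t - proj N (u t)) ≤ Q := by
      calc _ ≤ (1 + N : ℝ) ^ 10 * (1 + N) * (Q / (1 + N) ^ 11) :=
            h2.trans (by gcongr; exact sqrt_card_le N)
        _ = Q := by field_simp
    have h4 : wn N 10 (proj N (u t)) ≤ A := by
      rw [proj_eq_mult]
      exact (wn_mult_le N 10 0 (by simp) _).trans
        ((wn_mono N (by norm_num) _).trans (hA t ht N))
    have h5 := wn_add_le N 10 (uN t - proj N (u t)) (proj N (u t))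
    rw [sub_add_cancel] at h5
    linarith
  · have h1 : ‖toL2 (uN t)‖ ≤ 3 * A := by
      rw [norm_toL2_const hN t ht]
      exact (norm_toL2_le _).trans
        (mul_le_mul sqrt_two_pi_le (norm_proj_le (hA 0 h0) N) (norm_nonneg _) (by norm_num))
    have h2 : wn N 10 (uN t) ≤ (Q ^ 2) ^ 11 * (3 * A) := by
      calc _ ≤ (1 + N : ℝ) ^ 10 * (1 + N) * (3 * A) :=
            (wn_le_norm_toL2 10 (hN.mem t ht)).trans (by gcongr; exact sqrt_card_le N)
        _ = (1 + N : ℝ) ^ 11 * (3 * A) := by ring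
        _ ≤ _ := by gcongr
    linarith

/-! ### Expansion of the vector field -/

/-- The part of `v ↦ v v v̄` at `W + d` that is linear in `d`. -/
def cubLin (W d : C(Circ, ℂ)) : C(Circ, ℂ) :=
  W * d * star W + W * d * star W + W * W * star d

/-- The part of `v ↦ v v v̄` at `W + d` that is quadratic in `d`. -/
def cubQuad (W d : C(Circ, ℂ)) : C(Circ, ℂ) :=
  d * d * star W + W * d * star d + W * d * star d

/-- The polarization of `cubQuad W`. -/
def cubPolar (W d e : C(Circ, ℂ)) : C(Circ, ℂ) :=
  d * e * star W + d * e * star W + W * d * star e + W * d * star e + W * e * star d +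
    W * e * star d

/-- The derivative, as a real-linear map, of the semidiscrete vector field at `W`. -/
def jac (s : ℝ) (N : ℕ) (W d : C(Circ, ℂ)) : C(Circ, ℂ) :=
  linPart s N d + iProj N (cubLin W d)

theorem mult_real_smul (N : ℕ) (a : ℤ → ℂ) (c : ℝ) (v : C(Circ, ℂ)) :
    mult N a (c • v) = c • mult N a v :=
  ((mult N a).restrictScalars ℝ).map_smul c v

theorem linPart_real_smul (s : ℝ) (N : ℕ) (c : ℝ) (v : C(Circ, ℂ)) :
    linPart s N (c • v) = c • linPart s N v := mult_real_smul N _ c v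

theorem iProj_real_smul (N : ℕ) (c : ℝ) (v : C(Circ, ℂ)) :
    iProj N (c • v) = c • iProj N v := mult_real_smul N _ c v

theorem jac_add (s : ℝ) (N : ℕ) (W d e : C(Circ, ℂ)) :
    jac s N W (d + e) = jac s N W d + jac s N W e := by
  have h : cubLin W (d + e) = cubLin W d + cubLin W e := by
    simp only [cubLin, star_add]; ring
  rw [jac, h, map_add, map_add, jac, jac]; abel

theorem jac_smul (s : ℝ) (N : ℕ) (W : C(Circ, ℂ)) (c : ℝ) (d : C(Circ, ℂ)) :
    jac s N W (c • d) = c • jac s N W d := by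
  have h : cubLin W (c • d) = c • cubLin W d := by
    ext x
    simp [cubLin, mul_assoc]
  rw [jac, h, linPart_real_smul, iProj_real_smul, jac, smul_add]

theorem cubQuad_smul (W d : C(Circ, ℂ)) (c : ℝ) : cubQuad W (c • d) = c ^ 2 • cubQuad W d := by
  ext x
  simp [cubQuad]
  ring

theorem cubPolar_smul (W d e : C(Circ, ℂ)) (c c' : ℝ) :
    cubPolar W (c • d) (c' • e) = (c * c') • cubPolar W d e := by
  ext x
  simp [cubPolar]; ring

theorem cub_smul (d : C(Circ, ℂ)) (c : ℝ) :
    (c • d) * (c • d) * star (c • d) = c ^ 3 • (d * d * star d) := by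
  ext x
  simp; ring

/-- The coefficient of `k⁴` left over when `|v|² v` is expanded at `W + k a + k² b + k³ g`. -/
def cubRem (k : ℝ) (W a b g : C(Circ, ℂ)) : C(Circ, ℂ) :=
  cubQuad W b + cubPolar W a g + k • cubPolar W b g + k ^ 2 • cubQuad W g +
    (cubLin a (b + k • g) + k • cubQuad a (b + k • g) +
      k ^ 2 • ((b + k • g) * (b + k • g) * star (b + k • g)))

theorem cub_expand (k : ℝ) (W a b g : C(Circ, ℂ)) :
    (W + (k • a + k ^ 2 • b + k ^ 3 • g)) * (W + (k • a + k ^ 2 • b + k ^ 3 • g)) *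
        star (W + (k • a + k ^ 2 • b + k ^ 3 • g)) =
      W * W * star W + cubLin W (k • a + k ^ 2 • b + k ^ 3 • g) + k ^ 2 • cubQuad W a +
        k ^ 3 • (cubPolar W a b + a * a * star a) + k ^ 4 • cubRem k W a b g := by
  ext x
  simp [cubRem, cubLin, cubPolar, cubQuad]; ring

/-- Expansion of the vector field to third order in `k`. The remainder is explicit, so that bounding
it needs only the boundedness of the multilinear operations. -/
theorem rhs_expand (s : ℝ) {N : ℕ} (k : ℝ) {W a b g h : C(Circ, ℂ)} (hW : W ∈ trigPoly N)
    (ha : a ∈ trigPoly N) (hb : b ∈ trigPoly N) (hg : g ∈ trigPoly N) (hh : h ∈ trigPoly N) :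
    rhs s N (W + (k • a + k ^ 2 • b + k ^ 3 • (g + k • h))) =
      rhs s N W + k • jac s N W a + k ^ 2 • (jac s N W b + iProj N (cubQuad W a)) +
        k ^ 3 • (jac s N W g + iProj N (cubPolar W a b + a * a * star a)) +
        k ^ 4 • (jac s N W h + iProj N (cubRem k W a b (g + k • h))) := by
  have hgh : g + k • h ∈ trigPoly N := Submodule.add_mem _ hg (trigPoly_real_smul hh _)
  have hd : k • a + k ^ 2 • b + k ^ 3 • (g + k • h) ∈ trigPoly N :=
    Submodule.add_mem _ (Submodule.add_mem _ (trigPoly_real_smul ha _)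
      (trigPoly_real_smul hb _)) (trigPoly_real_smul hgh _)
  have hj : linPart s N (k • a + k ^ 2 • b + k ^ 3 • (g + k • h)) +
      iProj N (cubLin W (k • a + k ^ 2 • b + k ^ 3 • (g + k • h))) =
      k • jac s N W a + k ^ 2 • jac s N W b + k ^ 3 • (jac s N W g + k • jac s N W h) := by
    rw [← jac]; simp only [jac_add, jac_smul]
  rw [rhs_of_mem s (Submodule.add_mem _ hW hd), rhs_of_mem s hW, cub_expand]
  simp only [map_add (iProj N), iProj_real_smul]
  rw [map_add (linPart s N) W]
  have h2 := sub_eq_iff_eq_add.2 hj.symm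
  rw [← h2]
  module

/-! ### Families bounded uniformly in `N` -/

/-- A family of trigonometric polynomials, of possibly unbounded degrees `N i`, whose weighted
norms of order `r` are bounded. -/
def BddFam {ι : Type*} (N : ι → ℕ) (r : ℕ) (x : ι → C(Circ, ℂ)) : Prop :=
  (∀ i, x i ∈ trigPoly (N i)) ∧ ∃ K : ℝ, ∀ i, wn (N i) r (x i) ≤ K

theorem exists_abs_pow_le {ι : Type*} {k : ι → ℝ} (hk : ∃ K : ℝ, ∀ i, |k i| ≤ K) (n : ℕ) :
    ∃ K : ℝ, ∀ i, |k i ^ n| ≤ K := by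
  obtain ⟨K, hK⟩ := hk
  exact ⟨K ^ n, fun i => by rw [abs_pow]; exact pow_le_pow_left₀ (abs_nonneg _) (hK i) n⟩

namespace BddFam

variable {ι : Type*} {N : ι → ℕ} {r : ℕ} {x y z : ι → C(Circ, ℂ)}

theorem mono {q : ℕ} (hx : BddFam N q x) (h : r ≤ q) : BddFam N r x := by
  obtain ⟨hm, K, hK⟩ := hx
  exact ⟨hm, K, fun i => (wn_mono _ h _).trans (hK i)⟩

theorem add (hx : BddFam N r x) (hy : BddFam N r y) : BddFam N r fun i => x i + y i := by
  obtain ⟨hm, K, hK⟩ := hx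
  obtain ⟨hm', K', hK'⟩ := hy
  exact ⟨fun i => Submodule.add_mem _ (hm i) (hm' i), K + K', fun i =>
    (wn_add_le _ _ _ _).trans (add_le_add (hK i) (hK' i))⟩

theorem smul {c : ι → ℝ} (hc : ∃ K : ℝ, ∀ i, |c i| ≤ K) (hx : BddFam N r x) :
    BddFam N r fun i => c i • x i := by
  obtain ⟨hm, K, hK⟩ := hx
  obtain ⟨K', hK'⟩ := hc
  refine ⟨fun i => trigPoly_real_smul (hm i) _, K' * K, fun i => ?_⟩
  rw [wn_real_smul]
  exact mul_le_mul (hK' i) (hK i) (wn_nonneg _ _ _) ((abs_nonneg _).trans (hK' i))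

theorem const_smul (c : ℝ) (hx : BddFam N r x) : BddFam N r fun i => c • x i :=
  smul ⟨|c|, fun _ => le_rfl⟩ hx

theorem linPart {s : ℝ} (hs0 : 0 < s) (hs1 : s ≤ 1) (hx : BddFam N (r + 2) x) :
    BddFam N r fun i => linPart s (N i) (x i) := by
  obtain ⟨_, K, hK⟩ := hx
  exact ⟨fun i => mult_mem _ _ _, K, fun i => (wn_linPart_le hs0 hs1 _ _ _).trans (hK i)⟩

theorem tri (hx : BddFam N r x) (hy : BddFam N r y) (hz : BddFam N r z) :
    BddFam N r fun i => iProj (N i) (x i * y i * star (z i)) := by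
  obtain ⟨hm, K, hK⟩ := hx
  obtain ⟨hm', K', hK'⟩ := hy
  obtain ⟨hm'', K'', hK''⟩ := hz
  refine ⟨fun i => mult_mem _ _ _, K * K' * K'', fun i => ?_⟩
  have h0 := (wn_nonneg _ _ _).trans (hK i)
  have h0' := (wn_nonneg _ _ _).trans (hK' i)
  refine (wn_iProj_le _ _ _).trans ((wn_mul_mul_star_le r (hm i) (hm' i) (hm'' i)).trans ?_)
  exact mul_le_mul (mul_le_mul (hK i) (hK' i) (wn_nonneg _ _ _) h0) (hK'' i) (wn_nonneg _ _ _)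
    (mul_nonneg h0 h0')

theorem cubLin (hx : BddFam N r x) (hy : BddFam N r y) :
    BddFam N r fun i => iProj (N i) (cubLin (x i) (y i)) := by
  simp only [FNLS.cubLin, map_add]
  exact ((tri hx hy hx).add (tri hx hy hx)).add (tri hx hx hy)

theorem cubQuad (hx : BddFam N r x) (hy : BddFam N r y) :
    BddFam N r fun i => iProj (N i) (cubQuad (x i) (y i)) := by
  simp only [FNLS.cubQuad, map_add]
  exact ((tri hy hy hx).add (tri hx hy hy)).add (tri hx hy hy)

theorem cubPolar (hx : BddFam N r x) (hy : BddFam N r y) (hz : BddFam N r z) :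
    BddFam N r fun i => iProj (N i) (cubPolar (x i) (y i) (z i)) := by
  simp only [FNLS.cubPolar, map_add]
  exact (((((tri hy hz hx).add (tri hy hz hx)).add (tri hx hy hz)).add (tri hx hy hz)).add
    (tri hx hz hy)).add (tri hx hz hy)

theorem jac {s : ℝ} (hs0 : 0 < s) (hs1 : s ≤ 1) (hx : BddFam N r x) (hy : BddFam N (r + 2) y) :
    BddFam N r fun i => jac s (N i) (x i) (y i) :=
  (linPart hs0 hs1 hy).add (cubLin hx (hy.mono (Nat.le_add_right _ _)))

theorem rhs {s : ℝ} (hs0 : 0 < s) (hs1 : s ≤ 1) (hx : BddFam N (r + 2) x) :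
    BddFam N r fun i => rhs s (N i) (x i) := by
  have h : (fun i => FNLS.rhs s (N i) (x i)) = fun i =>
      FNLS.linPart s (N i) (x i) + iProj (N i) (x i * x i * star (x i)) :=
    funext fun i => rhs_of_mem s (hx.1 i)
  rw [h]
  have hx' := hx.mono (Nat.le_add_right r 2)
  exact (linPart hs0 hs1 hx).add (tri hx' hx' hx')

theorem cubRem {k : ι → ℝ} (hk : ∃ K : ℝ, ∀ i, |k i| ≤ K) {a b g : ι → C(Circ, ℂ)}
    (hx : BddFam N r x) (ha : BddFam N r a) (hb : BddFam N r b) (hg : BddFam N r g) :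
    BddFam N r fun i => iProj (N i) (cubRem (k i) (x i) (a i) (b i) (g i)) := by
  have hk2 := exists_abs_pow_le hk 2
  have hbg : BddFam N r fun i => b i + k i • g i := hb.add (smul hk hg)
  simp only [FNLS.cubRem, map_add (iProj _), iProj_real_smul]
  exact ((((cubQuad hx hb).add (cubPolar hx ha hg)).add (smul hk (cubPolar hx hb hg))).add
    (smul hk2 (cubQuad hx hg))).add (((cubLin ha hbg).add (smul hk (cubQuad ha hbg))).add
      (smul hk2 (tri hbg hbg hbg)))

end BddFam

/-! ### Elementary differentials -/

/-- The elementary differential `F'F`, which is the second time derivative of the solution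
through `W`. -/
def ed2 (s : ℝ) (N : ℕ) (W : C(Circ, ℂ)) : C(Circ, ℂ) := jac s N W (rhs s N W)

/-- The elementary differential `F'F'F`. -/
def ed3 (s : ℝ) (N : ℕ) (W : C(Circ, ℂ)) : C(Circ, ℂ) := jac s N W (ed2 s N W)

/-- The elementary differential `F''(F, F) / 2`. -/
def ed3' (s : ℝ) (N : ℕ) (W : C(Circ, ℂ)) : C(Circ, ℂ) := iProj N (cubQuad W (rhs s N W))

/-- The combination `∑ cᵢ kⁿ⁽ⁱ⁾ Dᵢ` of the elementary differentials `Dᵢ` of order `n(i) ≤ 4` at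
`W`. The entries of `c` belong, in turn, to `F`, `F'F`, `F'F'F`, `F''(F,F)/2`, `F'F'F'F`,
`F'F''(F,F)/2`, `F''(F,F'F)` and `F'''(F,F,F)/6`. -/
def series (s : ℝ) (N : ℕ) (W : C(Circ, ℂ)) (c : Fin 8 → ℝ) (k : ℝ) : C(Circ, ℂ) :=
  W + (k • c 0 • rhs s N W + k ^ 2 • c 1 • ed2 s N W +
    k ^ 3 • ((c 2 • ed3 s N W + c 3 • ed3' s N W) +
      k • (c 4 • jac s N W (ed3 s N W) + c 5 • jac s N W (ed3' s N W) +
        c 6 • iProj N (cubPolar W (rhs s N W) (ed2 s N W)) +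
        c 7 • iProj N (rhs s N W * rhs s N W * star (rhs s N W)))))

/-- The terms of order at most three in the expansion of `F (series s N W c k)`. -/
def rhsSeries (s : ℝ) (N : ℕ) (W : C(Circ, ℂ)) (c : Fin 8 → ℝ) (k : ℝ) : C(Circ, ℂ) :=
  rhs s N W + k • c 0 • ed2 s N W + k ^ 2 • (c 1 • ed3 s N W + c 0 ^ 2 • ed3' s N W) +
    k ^ 3 • (c 2 • jac s N W (ed3 s N W) + c 3 • jac s N W (ed3' s N W) +
      (c 0 * c 1) • iProj N (cubPolar W (rhs s N W) (ed2 s N W)) +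
      c 0 ^ 3 • iProj N (rhs s N W * rhs s N W * star (rhs s N W)))

section

variable {ι : Type*} {N : ι → ℕ} {s : ℝ} {W : ι → C(Circ, ℂ)} {k : ι → ℝ}

theorem BddFam.ed2 (hs0 : 0 < s) (hs1 : s ≤ 1) (hW : BddFam N 10 W) :
    BddFam N 6 fun i => ed2 s (N i) (W i) :=
  BddFam.jac hs0 hs1 (hW.mono (by norm_num)) (BddFam.rhs (r := 8) hs0 hs1 hW)

theorem BddFam.ed3 (hs0 : 0 < s) (hs1 : s ≤ 1) (hW : BddFam N 10 W) :
    BddFam N 4 fun i => ed3 s (N i) (W i) :=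
  BddFam.jac hs0 hs1 (hW.mono (by norm_num)) (BddFam.ed2 hs0 hs1 hW)

theorem BddFam.ed3' (hs0 : 0 < s) (hs1 : s ≤ 1) (hW : BddFam N 10 W) :
    BddFam N 4 fun i => ed3' s (N i) (W i) :=
  BddFam.cubQuad (hW.mono (by norm_num)) (BddFam.rhs (r := 4) hs0 hs1 (hW.mono (by norm_num)))

/-- The fourth-order elementary differentials. -/
theorem BddFam.top (hs0 : 0 < s) (hs1 : s ≤ 1) (hW : BddFam N 10 W) (c : Fin 8 → ℝ) :
    BddFam N 2 fun i => c 4 • FNLS.jac s (N i) (W i) (FNLS.ed3 s (N i) (W i)) +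
      c 5 • FNLS.jac s (N i) (W i) (FNLS.ed3' s (N i) (W i)) +
      c 6 • iProj (N i) (FNLS.cubPolar (W i) (FNLS.rhs s (N i) (W i)) (FNLS.ed2 s (N i) (W i))) +
      c 7 • iProj (N i) (FNLS.rhs s (N i) (W i) * FNLS.rhs s (N i) (W i) *
        star (FNLS.rhs s (N i) (W i))) := by
  have hW2 : BddFam N 2 W := hW.mono (by norm_num)
  have h1 : BddFam N 2 fun i => FNLS.rhs s (N i) (W i) :=
    BddFam.rhs hs0 hs1 (hW.mono (by norm_num))
  have h2 := (BddFam.ed2 hs0 hs1 hW).mono (show 2 ≤ 6 by norm_num)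
  exact ((((BddFam.jac hs0 hs1 hW2 (BddFam.ed3 hs0 hs1 hW)).const_smul _).add
    ((BddFam.jac hs0 hs1 hW2 (BddFam.ed3' hs0 hs1 hW)).const_smul _)).add
    ((BddFam.cubPolar hW2 h1 h2).const_smul _)).add ((BddFam.tri h1 h1 h1).const_smul _)

theorem BddFam.series (hs0 : 0 < s) (hs1 : s ≤ 1) (hW : BddFam N 10 W) (c : Fin 8 → ℝ)
    (hk : ∃ K : ℝ, ∀ i, |k i| ≤ K) : BddFam N 2 fun i => series s (N i) (W i) c (k i) := by
  have h1 : BddFam N 2 fun i => FNLS.rhs s (N i) (W i) :=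
    BddFam.rhs hs0 hs1 (hW.mono (by norm_num))
  have h2 := (BddFam.ed2 hs0 hs1 hW).mono (show 2 ≤ 6 by norm_num)
  have h3 := (BddFam.ed3 hs0 hs1 hW).mono (show 2 ≤ 4 by norm_num)
  have h4 := (BddFam.ed3' hs0 hs1 hW).mono (show 2 ≤ 4 by norm_num)
  exact (hW.mono (by norm_num)).add (((smul hk (h1.const_smul _)).add
    (smul (exists_abs_pow_le hk 2) (h2.const_smul _))).add (smul (exists_abs_pow_le hk 3)
      (((h3.const_smul _).add (h4.const_smul _)).add (smul hk (BddFam.top hs0 hs1 hW c)))))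

/-- Expansion of the vector field along a truncated series, with a remainder that is bounded
uniformly in the degree. Ten derivatives of `W` are spent: two for each of the five applications
of the vector field. -/
theorem exists_rhs_series_eq (hs0 : 0 < s) (hs1 : s ≤ 1) (hW : BddFam N 10 W) (c : Fin 8 → ℝ)
    (hk : ∃ K : ℝ, ∀ i, |k i| ≤ K) :
    ∃ E : ι → C(Circ, ℂ), BddFam N 0 E ∧ ∀ i, rhs s (N i) (series s (N i) (W i) c (k i)) =
      rhsSeries s (N i) (W i) c (k i) + k i ^ 4 • E i := by
  have h1 : BddFam N 0 fun i => c 0 • FNLS.rhs s (N i) (W i) :=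
    (BddFam.rhs hs0 hs1 (hW.mono (by norm_num))).const_smul _
  have h2 : BddFam N 0 fun i => c 1 • FNLS.ed2 s (N i) (W i) :=
    ((BddFam.ed2 hs0 hs1 hW).mono (by norm_num)).const_smul _
  have h3 : BddFam N 0 fun i => c 2 • FNLS.ed3 s (N i) (W i) + c 3 • FNLS.ed3' s (N i) (W i) :=
    (((BddFam.ed3 hs0 hs1 hW).mono (by norm_num)).const_smul _).add
      (((BddFam.ed3' hs0 hs1 hW).mono (by norm_num)).const_smul _)
  have h4 := BddFam.top hs0 hs1 hW c
  have hW0 : BddFam N 0 W := hW.mono (by norm_num)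
  refine ⟨_, (BddFam.jac hs0 hs1 hW0 h4).add (BddFam.cubRem hk hW0 h1 h2
    (h3.add (BddFam.smul hk (h4.mono (by norm_num))))), fun i => ?_⟩
  rw [series, rhs_expand s (k i) (hW.1 i) (h1.1 i) (h2.1 i) (h3.1 i) (h4.1 i), rhsSeries]
  congr 1
  rw [cubQuad_smul, cubPolar_smul, cub_smul]
  simp only [jac_add, jac_smul, map_add (iProj _), iProj_real_smul]
  simp only [FNLS.ed2, FNLS.ed3, FNLS.ed3']
  module

end

/-! ### Stability of a midpoint step -/

/-- The vector field being skew up to its Lipschitz cubic part, a midpoint step with residual `ρ`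
depends stably on the data, whatever the size of `k N^{2s}`. -/
theorem norm_toL2_step_sub_le {s κ : ℝ} {N : ℕ} {Z Z' X X' ρ : C(Circ, ℂ)}
    (hZ : Z ∈ trigPoly N) (hZ' : Z' ∈ trigPoly N) (hX : X ∈ trigPoly N) (hX' : X' ∈ trigPoly N)
    (h : Z' = Z + κ • rhs s N ((1 / 2 : ℝ) • (Z' + Z)))
    (h' : X' = X + κ • rhs s N ((1 / 2 : ℝ) • (X' + X)) + ρ)
    (hκ : |κ| * (3 / 2 * (‖(1 / 2 : ℝ) • (Z' + Z)‖ ^ 2 + ‖(1 / 2 : ℝ) • (X' + X)‖ ^ 2)) ≤ 1) :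
    ‖toL2 (Z' - X')‖ ≤ 3 * ‖toL2 (Z - X)‖ + 2 * ‖toL2 ρ‖ := by
  set Y := (1 / 2 : ℝ) • (Z' + Z) with hY
  set V := (1 / 2 : ℝ) • (X' + X) with hV
  have hYm : Y ∈ trigPoly N := trigPoly_real_smul (Submodule.add_mem _ hZ' hZ) _
  have hVm : V ∈ trigPoly N := trigPoly_real_smul (Submodule.add_mem _ hX' hX) _
  have hsum : (Z' - X') + (Z - X) = (2 : ℝ) • (Y - V) := by rw [hY, hV]; module
  have hdiff : (Z' - X') - (Z - X) = κ • (rhs s N Y - rhs s N V) - ρ := by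
    have e1 : Z' - Z = κ • rhs s N Y := by rw [sub_eq_iff_eq_add']; exact h
    have e2 : X' - X = κ • rhs s N V + ρ := by
      rw [sub_eq_iff_eq_add', ← add_assoc]; exact h'
    have e3 : (Z' - X') - (Z - X) = (Z' - Z) - (X' - X) := by abel
    rw [e3, e1, e2, smul_sub]
    abel
  have hL := inner_rhs_sub_le s hYm hVm
  set a := toL2 (Z' - X') with ha
  set b := toL2 (Z - X) with hb
  have h1 : inner ℝ (a + b) (a - b) = ‖a‖ ^ 2 - ‖b‖ ^ 2 := by
    rw [inner_add_left, inner_sub_right, inner_sub_right, real_inner_self_eq_norm_sq,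
      real_inner_self_eq_norm_sq, real_inner_comm]; ring
  have h2 : a - b = κ • toL2 (rhs s N Y - rhs s N V) - toL2 ρ := by
    rw [ha, hb, ← map_sub, hdiff, map_sub, map_smul]
  have h3 : a + b = (2 : ℝ) • toL2 (Y - V) := by
    rw [ha, hb, ← map_add, hsum, map_smul]
  have h4 : ‖toL2 (Y - V)‖ = ‖a + b‖ / 2 := by
    rw [h3, norm_smul]; simp
  have h5 : ‖a‖ ^ 2 - ‖b‖ ^ 2 ≤ (1 / 2 * ‖a + b‖ + ‖toL2 ρ‖) * ‖a + b‖ := by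
    rw [← h1]
    conv_lhs => rw [h2, inner_sub_right, inner_smul_right]
    have h6 := neg_le_of_abs_le (abs_real_inner_le_norm (a + b) (toL2 ρ))
    have h7 : κ * inner ℝ (a + b) (toL2 (rhs s N Y - rhs s N V)) ≤ 1 / 2 * ‖a + b‖ ^ 2 := by
      rw [h3, inner_smul_left]
      simp only [conj_trivial]
      refine (le_abs_self _).trans ?_
      rw [← h3, abs_mul, abs_mul, abs_two]
      calc |κ| * (2 * |inner ℝ (toL2 (Y - V)) (toL2 (rhs s N Y - rhs s N V))|)
          ≤ |κ| * (2 * (3 / 2 * (‖Y‖ ^ 2 + ‖V‖ ^ 2) * ‖toL2 (Y - V)‖ ^ 2)) := by gcongr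
        _ = |κ| * (3 / 2 * (‖Y‖ ^ 2 + ‖V‖ ^ 2)) * (2 * ‖toL2 (Y - V)‖ ^ 2) := by ring
        _ ≤ 1 * (2 * ‖toL2 (Y - V)‖ ^ 2) := by gcongr
        _ = 1 / 2 * ‖a + b‖ ^ 2 := by rw [h4]; ring
    nlinarith
  have h8 : ‖a + b‖ ≤ ‖a‖ + ‖b‖ := norm_add_le _ _
  have h9 : (‖a‖ - ‖b‖) * (‖a‖ + ‖b‖) ≤
      (1 / 2 * (‖a‖ + ‖b‖) + ‖toL2 ρ‖) * (‖a‖ + ‖b‖) := by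
    calc _ = ‖a‖ ^ 2 - ‖b‖ ^ 2 := by ring
      _ ≤ _ := h5
      _ ≤ _ := by gcongr
  rcases (add_nonneg (norm_nonneg a) (norm_nonneg b)).eq_or_lt with h0 | h0
  · linarith [norm_nonneg a, norm_nonneg b, norm_nonneg (toL2 ρ)]
  · linarith [le_of_mul_le_mul_right h9 h0]

/-- The midpoint rule conserves the `L²` norm. -/
theorem norm_toL2_step {s κ : ℝ} {N : ℕ} {Z Z' : C(Circ, ℂ)}
    (hZ : Z ∈ trigPoly N) (hZ' : Z' ∈ trigPoly N)
    (h : Z' = Z + κ • rhs s N ((1 / 2 : ℝ) • (Z' + Z))) : ‖toL2 Z'‖ = ‖toL2 Z‖ := by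
  set Y := (1 / 2 : ℝ) • (Z' + Z) with hY
  have hYm : Y ∈ trigPoly N := trigPoly_real_smul (Submodule.add_mem _ hZ' hZ) _
  have h1 : inner ℝ (toL2 Z' + toL2 Z) (toL2 Z' - toL2 Z) = 0 := by
    have e1 : toL2 Z' + toL2 Z = (2 : ℝ) • toL2 Y := by
      rw [hY, map_smul, map_add, smul_smul]; norm_num
    have e2 : toL2 Z' - toL2 Z = κ • toL2 (rhs s N Y) := by
      conv_lhs => rw [h, map_add, map_smul]
      abel
    rw [e1, e2, inner_smul_left, inner_smul_right, inner_rhs hYm]; simp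
  rw [inner_add_left, inner_sub_right, inner_sub_right, real_inner_self_eq_norm_sq,
      real_inner_self_eq_norm_sq, real_inner_comm] at h1
  exact (pow_left_inj₀ (norm_nonneg _) (norm_nonneg _) two_ne_zero).1 (by linarith)

theorem norm_toL2_midpoint_le {s κ : ℝ} {N : ℕ} {Z Z' : C(Circ, ℂ)}
    (hZ : Z ∈ trigPoly N) (hZ' : Z' ∈ trigPoly N)
    (h : Z' = Z + κ • rhs s N ((1 / 2 : ℝ) • (Z' + Z))) :
    ‖toL2 ((1 / 2 : ℝ) • (Z' + Z))‖ ≤ ‖toL2 Z‖ := by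
  rw [map_smul, map_add, norm_smul]
  have h1 := norm_add_le (toL2 Z') (toL2 Z)
  rw [norm_toL2_step hZ hZ' h] at h1
  norm_num
  linarith

/-! ### Sup norm bounds on the midpoints -/

/-- Under a restriction on `k N` the sup norm bound follows from the inverse inequality and
`2N + 1 ≤ 3N`. -/
theorem mul_norm_midpoint_sq_le_of_cfl {s k b R : ℝ} {N : ℕ} {Z Z' : C(Circ, ℂ)} (hk : 0 < k)
    (hN : 1 ≤ N) (hZ : Z ∈ trigPoly N) (hZ' : Z' ∈ trigPoly N)
    (h : Z' = Z + (k * b) • rhs s N ((1 / 2 : ℝ) • (Z' + Z))) (hR : ‖toL2 Z‖ = R)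
    (hcfl : 3 * R ^ 2 * k * N * |b| < 1) :
    |k * b| * ‖(1 / 2 : ℝ) • (Z' + Z)‖ ^ 2 ≤ 1 / 6 := by
  have h1 := norm_sq_le_of_mem (trigPoly_real_smul (Submodule.add_mem _ hZ' hZ) (1 / 2 : ℝ))
  have h2 := norm_toL2_midpoint_le hZ hZ' h
  have hN' : (1 : ℝ) ≤ N := by exact_mod_cast hN
  rw [hR] at h2
  rw [abs_mul, abs_of_pos hk]
  calc _ ≤ k * |b| * ((2 * N + 1) / (2 * Real.pi) * R ^ 2) := by
        gcongr
        refine h1.trans ?_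
        gcongr
    _ ≤ k * |b| * (3 * N / (2 * Real.pi) * R ^ 2) := by gcongr; linarith
    _ = (3 * R ^ 2 * k * N * |b|) / (2 * Real.pi) := by ring
    _ ≤ 1 / (2 * Real.pi) := by gcongr
    _ ≤ 1 / 6 := by gcongr; linarith [Real.pi_gt_three]

/-- For `s > 1/2` the kernel of the resolvent `(1 + κ (-∂ₓₓ)^s)⁻¹` has sup norm `o(1/κ)` as
`κ → 0`. -/
theorem exists_sum_resolvent_le {s ε : ℝ} (hs : 1 / 2 < s) (hε : 0 < ε) :
    ∃ κ₀ : ℝ, 0 < κ₀ ∧ ∀ κ : ℝ, 0 ≤ κ → κ ≤ κ₀ → ∀ N : ℕ,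
      ∑ m ∈ modes N, κ / (1 + κ * |(m : ℝ)| ^ (2 * s)) ≤ ε := by
  set bound : ℤ → ℝ := fun m => |(m : ℝ)| ^ (-(2 * s)) + if m = 0 then 1 else 0 with hbd
  have hsum : Summable bound := by
    refine (Real.summable_abs_int_rpow (by linarith)).add ?_
    exact summable_of_hasFiniteSupport ((Set.finite_singleton (0 : ℤ)).subset fun m hm => by
      by_contra h
      exact hm (if_neg h))
  have hb : ∀ κ : ℝ, 0 ≤ κ → κ ≤ 1 → ∀ m : ℤ,
      ‖κ / (1 + κ * |(m : ℝ)| ^ (2 * s))‖ ≤ bound m := by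
    intro κ h0 h1 m
    rw [Real.norm_of_nonneg (by positivity)]
    rcases eq_or_ne m 0 with rfl | hm
    · simp only [hbd, if_true]
      have : (0 : ℝ) < 2 * s := by linarith
      simp only [Int.cast_zero, abs_zero, Real.zero_rpow this.ne', mul_zero, add_zero, div_one]
      linarith [Real.rpow_nonneg le_rfl (-(2 * s))]
    · simp only [hbd, if_neg hm, add_zero]
      have hm' : 0 < |(m : ℝ)| := abs_pos.2 (by exact_mod_cast hm)
      have hp := Real.rpow_pos_of_pos hm' (2 * s)
      rw [Real.rpow_neg hm'.le, div_le_iff₀ (by positivity)]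
      have : (|(m : ℝ)| ^ (2 * s))⁻¹ * (1 + κ * |(m : ℝ)| ^ (2 * s)) =
          (|(m : ℝ)| ^ (2 * s))⁻¹ + κ := by field_simp
      rw [this]
      linarith [inv_pos.2 hp]
  have ht : Filter.Tendsto (fun κ : ℝ => ∑' m : ℤ, κ / (1 + κ * |(m : ℝ)| ^ (2 * s)))
      (nhdsWithin 0 (Set.Ici 0)) (nhds (∑' _ : ℤ, (0 : ℝ))) := by
    refine tendsto_tsum_of_dominated_convergence hsum (fun m => ?_) ?_
    · have : ContinuousAt (fun κ : ℝ => κ / (1 + κ * |(m : ℝ)| ^ (2 * s))) 0 :=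
        ContinuousAt.div (by fun_prop) (by fun_prop) (by simp)
      have h := this.tendsto.mono_left (nhdsWithin_le_nhds (s := Set.Ici (0 : ℝ)))
      simpa using h
    · have h1 : ∀ᶠ κ : ℝ in nhdsWithin 0 (Set.Ici 0), κ ≤ 1 :=
        nhdsWithin_le_nhds (eventually_le_nhds zero_lt_one)
      filter_upwards [self_mem_nhdsWithin, h1] with κ h0 h1 m
      exact hb κ h0 h1 m
  rw [tsum_zero] at ht
  have hev := ht.eventually (eventually_le_nhds hε)
  obtain ⟨u, hu, hsub⟩ := mem_nhdsGE_iff_exists_Icc_subset.1 hev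
  refine ⟨min u 1, lt_min hu zero_lt_one, fun κ h0 h1 N => ?_⟩
  refine le_trans ?_ (hsub ⟨h0, h1.trans (min_le_left _ _)⟩)
  have hsm : Summable fun m : ℤ => κ / (1 + κ * |(m : ℝ)| ^ (2 * s)) :=
    Summable.of_norm_bounded hsum (hb κ h0 (h1.trans (min_le_right _ _)))
  exact hsm.sum_le_tsum _ fun m _ => by positivity

theorem norm_toL2_cubic_le (v : C(Circ, ℂ)) :
    ‖toL2 (Complex.I • (v * v * star v))‖ ≤ ‖v‖ ^ 2 * ‖toL2 v‖ := by
  refine norm_toL2_le_of_pointwise (by positivity) fun x => ?_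
  have h2 := v.norm_coe_le_norm x
  simp only [ContinuousMap.coe_smul, ContinuousMap.coe_mul, ContinuousMap.coe_star, Pi.smul_apply,
    Pi.mul_apply, Pi.star_apply, norm_smul, norm_mul, norm_star, Complex.norm_I, one_mul]
  rw [← sq]
  gcongr

theorem inner_I_smul_linPart (s : ℝ) {N : ℕ} {v : C(Circ, ℂ)} (hv : v ∈ trigPoly N) :
    inner ℝ (toL2 (Complex.I • v)) (toL2 (linPart s N v)) =
      -(2 * Real.pi * ∑ m ∈ modes N, |(m : ℝ)| ^ (2 * s) * ‖coeff m v‖ ^ 2) := by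
  rw [linPart, inner_mult (Submodule.smul_mem _ _ hv), ← mul_neg, ← Finset.sum_neg_distrib]
  congr 1
  refine Finset.sum_congr rfl fun m _ => ?_
  have h : star (coeff m (Complex.I • v)) * (linSymbol s m * coeff m v) =
      ((-(|(m : ℝ)| ^ (2 * s)) : ℝ) : ℂ) * (star (coeff m v) * coeff m v) := by
    rw [map_smul, smul_eq_mul, star_mul', linSymbol, RCLike.star_def, Complex.conj_I]
    push_cast
    linear_combination (starRingEnd ℂ) (coeff m v) * coeff m v * ((|(m : ℝ)| ^ (2 * s) : ℝ) : ℂ) *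
      Complex.I_mul_I
  rw [h, Complex.re_ofReal_mul, RCLike.star_def, ← Complex.normSq_eq_conj_mul_self,
    Complex.ofReal_re, Complex.normSq_eq_norm_sq]
  ring

theorem inner_I_smul_self (v : C(Circ, ℂ)) : inner ℝ (toL2 (Complex.I • v)) (toL2 v) = 0 := by
  rw [inner_toL2]
  have : ∀ x : Circ, (star ((Complex.I • v) x) * v x).re = 0 := by
    intro x
    simp; ring
  simp_rw [this, MeasureTheory.integral_zero]

/-- The pairing of the midpoint equation with `i Y` bounds `κ` times the energy
`‖(-∂ₓₓ)^{s/2} Y‖²` of the midpoint `Y`. The factor `κ` is the price for the midpoint rule not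
conserving the Hamiltonian. -/
theorem energy_midpoint_le {s κ R : ℝ} {N : ℕ} {Z Z' Y : C(Circ, ℂ)}
    (hZ : Z ∈ trigPoly N) (hZ' : Z' ∈ trigPoly N) (hY : Y = (1 / 2 : ℝ) • (Z' + Z))
    (h : Z' = Z + κ • rhs s N Y) (hR : ‖toL2 Z‖ = R) :
    |κ| * (2 * Real.pi * ∑ m ∈ modes N, |(m : ℝ)| ^ (2 * s) * ‖coeff m Y‖ ^ 2) ≤
      2 * R ^ 2 + |κ| * ‖Y‖ ^ 2 * R ^ 2 := by
  have hYm : Y ∈ trigPoly N := hY ▸ trigPoly_real_smul (Submodule.add_mem _ hZ' hZ) _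
  have hYR : ‖toL2 Y‖ ≤ R := by
    have := norm_toL2_midpoint_le hZ hZ' (hY ▸ h)
    rwa [← hY, hR] at this
  set E := 2 * Real.pi * ∑ m ∈ modes N, |(m : ℝ)| ^ (2 * s) * ‖coeff m Y‖ ^ 2 with hE
  have hE0 : 0 ≤ E := mul_nonneg (by positivity) (Finset.sum_nonneg fun m _ => by positivity)
  have hiY : ‖toL2 (Complex.I • Y)‖ ≤ 1 * ‖toL2 Y‖ :=
    norm_toL2_le_of_pointwise zero_le_one fun x => by simp
  rw [one_mul] at hiY
  have h1 : (2 : ℝ) • Y = (2 : ℝ) • Z + κ • rhs s N Y := by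
    conv_lhs => rw [hY, h]
    module
  have h2 := congrArg (fun v => inner ℝ (toL2 (Complex.I • Y)) (toL2 v)) h1
  simp only [map_smul, map_add, inner_add_right, inner_smul_right, inner_I_smul_self,
    rhs_of_mem s hYm, inner_I_smul_linPart s hYm, inner_iProj (Submodule.smul_mem _ Complex.I hYm)]
    at h2
  rw [← hE] at h2
  set p := inner ℝ (toL2 (Complex.I • Y)) (toL2 Z) with hp
  set q := inner ℝ (toL2 (Complex.I • Y)) (toL2 (Complex.I • (Y * Y * star Y))) with hq
  have hR0 : 0 ≤ R := hR ▸ norm_nonneg _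
  have hpb : |p| ≤ R * R := (abs_real_inner_le_norm _ _).trans
    (mul_le_mul (hiY.trans hYR) hR.le (norm_nonneg _) hR0)
  have hqb : |q| ≤ R * (‖Y‖ ^ 2 * R) := (abs_real_inner_le_norm _ _).trans
    (mul_le_mul (hiY.trans hYR) ((norm_toL2_cubic_le Y).trans (by gcongr)) (norm_nonneg _) hR0)
  have h3 : κ * E = 2 * p + κ * q := by linarith
  calc |κ| * E = |κ * E| := by rw [abs_mul, abs_of_nonneg hE0]
    _ ≤ 2 * |p| + |κ| * |q| := by
      rw [h3]
      refine (abs_add_le _ _).trans ?_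
      rw [abs_mul, abs_mul, abs_two]
    _ ≤ 2 * (R * R) + |κ| * (R * (‖Y‖ ^ 2 * R)) := by gcongr
    _ = _ := by ring

/-- For `s > 1/2` no restriction on `N` is needed. With `x = κ ‖Y‖²`, the energy bound and the
resolvent bound give `x ≤ (3 + x) / 20` for small `κ`. -/
theorem exists_mul_norm_midpoint_sq_le {s R₀ : ℝ} (hs : 1 / 2 < s) :
    ∃ κ₀ : ℝ, 0 < κ₀ ∧ ∀ (κ : ℝ) (N : ℕ) (Z Z' : C(Circ, ℂ)), |κ| ≤ κ₀ → Z ∈ trigPoly N →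
      Z' ∈ trigPoly N → Z' = Z + κ • rhs s N ((1 / 2 : ℝ) • (Z' + Z)) → ‖toL2 Z‖ ≤ R₀ →
      |κ| * ‖(1 / 2 : ℝ) • (Z' + Z)‖ ^ 2 ≤ 1 / 6 := by
  obtain ⟨κ₀, hκ₀, hsum⟩ := exists_sum_resolvent_le (ε := 1 / (20 * (R₀ ^ 2 + 1))) hs
    (by positivity)
  refine ⟨κ₀, hκ₀, fun κ N Z Z' hκ hZ hZ' h hR => ?_⟩
  have hYm := trigPoly_real_smul (Submodule.add_mem _ hZ' hZ) (1 / 2 : ℝ)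
  have hmid := norm_toL2_midpoint_le hZ hZ' h
  have hen := energy_midpoint_le hZ hZ' rfl h rfl
  set Y := (1 / 2 : ℝ) • (Z' + Z) with hY
  set R := ‖toL2 Z‖ with hRdef
  have hR0 : 0 ≤ R := norm_nonneg _
  have hres := hsum |κ| (abs_nonneg _) hκ N
  set S := ∑ m ∈ modes N, |(m : ℝ)| ^ (2 * s) * ‖coeff m Y‖ ^ 2 with hS
  have hcs : ‖Y‖ ^ 2 ≤ (∑ m ∈ modes N, 1 / (1 + |κ| * |(m : ℝ)| ^ (2 * s))) *
      ∑ m ∈ modes N, (1 + |κ| * |(m : ℝ)| ^ (2 * s)) * ‖coeff m Y‖ ^ 2 := by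
    calc ‖Y‖ ^ 2 ≤ (∑ m ∈ modes N, ‖coeff m Y‖) ^ 2 := by
          gcongr
          simpa [wn] using norm_le_wn hYm
      _ ≤ _ := by
          refine Finset.sum_sq_le_sum_mul_sum_of_sq_le_mul _ (fun m _ => by positivity)
            (fun m _ => by positivity) fun m _ => le_of_eq ?_
          field_simp
  have hQ : ∑ m ∈ modes N, (1 + |κ| * |(m : ℝ)| ^ (2 * s)) * ‖coeff m Y‖ ^ 2 =
      (‖toL2 Y‖ ^ 2 + |κ| * (2 * Real.pi * S)) / (2 * Real.pi) := by
    have e1 : ∑ m ∈ modes N, (1 + |κ| * |(m : ℝ)| ^ (2 * s)) * ‖coeff m Y‖ ^ 2 =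
        ∑ m ∈ modes N, ‖coeff m Y‖ ^ 2 + |κ| * S := by
      rw [hS, Finset.mul_sum, ← Finset.sum_add_distrib]
      exact Finset.sum_congr rfl fun m _ => by ring
    rw [e1, norm_sq_of_mem hYm]
    field_simp
  set x := |κ| * ‖Y‖ ^ 2 with hx
  have hx0 : 0 ≤ x := by positivity
  have hQb : ∑ m ∈ modes N, (1 + |κ| * |(m : ℝ)| ^ (2 * s)) * ‖coeff m Y‖ ^ 2 ≤
      R ^ 2 * (3 + x) := by
    rw [hQ, div_le_iff₀ (by positivity)]
    have e1 : ‖toL2 Y‖ ^ 2 ≤ R ^ 2 := by gcongr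
    have e2 : 0 ≤ R ^ 2 * (3 + x) := by positivity
    nlinarith [Real.pi_gt_three]
  have hfin : x ≤ 1 / (20 * (R₀ ^ 2 + 1)) * (R ^ 2 * (3 + x)) := by
    calc x ≤ |κ| * ((∑ m ∈ modes N, 1 / (1 + |κ| * |(m : ℝ)| ^ (2 * s))) *
          ∑ m ∈ modes N, (1 + |κ| * |(m : ℝ)| ^ (2 * s)) * ‖coeff m Y‖ ^ 2) := by
          rw [hx]; gcongr
      _ = (∑ m ∈ modes N, |κ| / (1 + |κ| * |(m : ℝ)| ^ (2 * s))) *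
          ∑ m ∈ modes N, (1 + |κ| * |(m : ℝ)| ^ (2 * s)) * ‖coeff m Y‖ ^ 2 := by
          rw [← mul_assoc]
          congr 1
          rw [Finset.mul_sum]
          simp_rw [mul_one_div]
      _ ≤ _ := by gcongr
  have hRR : R ^ 2 ≤ R₀ ^ 2 := by gcongr
  have h20 : 1 / (20 * (R₀ ^ 2 + 1)) * (R ^ 2 * (3 + x)) ≤ 1 / 20 * (3 + x) := by
    have e : 1 / (20 * (R₀ ^ 2 + 1)) * (R ^ 2 * (3 + x)) =
        1 / 20 * (3 + x) * (R ^ 2 / (R₀ ^ 2 + 1)) := by field_simp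
    rw [e]
    refine mul_le_of_le_one_right (by positivity) (div_le_one_of_le₀ ?_ (by positivity))
    linarith
  linarith

/-! ### Series of the composition method and of the flow -/

/-- The coefficients, through order `k⁴`, of the midpoint of a step of length `k b` started at coefficients `c`. -/
def midCoeff (b : ℝ) (c : Fin 8 → ℝ) : Fin 8 → ℝ :=
  ![c 0 + b / 2,
    c 1 + b / 2 * (c 0 + b / 2),
    c 2 + b / 2 * (c 1 + b / 2 * (c 0 + b / 2)),
    c 3 + b / 2 * (c 0 + b / 2) ^ 2,
    c 4 + b / 2 * (c 2 + b / 2 * (c 1 + b / 2 * (c 0 + b / 2))),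
    c 5 + b / 2 * (c 3 + b / 2 * (c 0 + b / 2) ^ 2),
    c 6 + b / 2 * ((c 0 + b / 2) * (c 1 + b / 2 * (c 0 + b / 2))),
    c 7 + b / 2 * (c 0 + b / 2) ^ 3]

/-- The coefficients, through order `k⁴`, of the result of a midpoint step of length `k b` started at
coefficients `c`. -/
def stepCoeff (b : ℝ) (c : Fin 8 → ℝ) : Fin 8 → ℝ := fun i => 2 * midCoeff b c i - c i

/-- The Taylor coefficients of the exact flow, in the basis used by `series`. -/
def flowCoeff : Fin 8 → ℝ := ![1, 1 / 2, 1 / 6, 1 / 3, 1 / 24, 1 / 12, 1 / 8, 1 / 4]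

theorem series_zero (s : ℝ) (N : ℕ) (W : C(Circ, ℂ)) (k : ℝ) : series s N W 0 k = W := by
  simp [series]

theorem series_midCoeff (s : ℝ) (N : ℕ) (W : C(Circ, ℂ)) (k b : ℝ) (c : Fin 8 → ℝ) :
    (1 / 2 : ℝ) • (series s N W (stepCoeff b c) k + series s N W c k) =
      series s N W (midCoeff b c) k := by
  simp only [series, stepCoeff]
  module

theorem series_stepCoeff_sub (s : ℝ) (N : ℕ) (W : C(Circ, ℂ)) (k b : ℝ) (c : Fin 8 → ℝ) :
    series s N W (stepCoeff b c) k =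
      series s N W c k + (k * b) • rhsSeries s N W (midCoeff b c) k := by
  simp only [series, stepCoeff, rhsSeries]
  simp [midCoeff]
  module

theorem hasDerivAt_series (s : ℝ) (N : ℕ) (W : C(Circ, ℂ)) (k : ℝ) :
    HasDerivAt (series s N W flowCoeff) (rhsSeries s N W flowCoeff k) k := by
  have hp : ∀ (n : ℕ) (v : C(Circ, ℂ)), HasDerivAt (fun x : ℝ => x ^ n • v)
      ((n * k ^ (n - 1) : ℝ) • v) k := fun n v => (hasDerivAt_pow n k).smul_const v
  have hs : series s N W flowCoeff = fun x : ℝ => W + (x ^ 1 • flowCoeff 0 • rhs s N W +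
      x ^ 2 • flowCoeff 1 • ed2 s N W +
      x ^ 3 • (flowCoeff 2 • ed3 s N W + flowCoeff 3 • ed3' s N W) +
      x ^ 4 • (flowCoeff 4 • jac s N W (ed3 s N W) + flowCoeff 5 • jac s N W (ed3' s N W) +
        flowCoeff 6 • iProj N (cubPolar W (rhs s N W) (ed2 s N W)) +
        flowCoeff 7 • iProj N (rhs s N W * rhs s N W * star (rhs s N W)))) := by
    ext1 x
    rw [series]
    module
  rw [hs]
  refine ((((hp 1 _).add (hp 2 _)).add (hp 3 _)).add (hp 4 _)).const_add W |>.congr_deriv ?_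
  simp only [rhsSeries]
  simp [flowCoeff]
  module

/-- The index set of all data `(N, W, k)` with `W ∈ S_N` in a ball of the weighted norm and
`0 ≤ k ≤ 1`. -/
abbrev Data (K : ℝ) : Type :=
  {p : ℕ × C(Circ, ℂ) × ℝ // p.2.1 ∈ trigPoly p.1 ∧ wn p.1 10 p.2.1 ≤ K ∧ 0 ≤ p.2.2 ∧ p.2.2 ≤ 1}

/-- Along a truncated series, the vector field is bounded and is given by its own expansion up to
`O(k⁴)`, uniformly in `N`. -/
theorem exists_series_bound {s : ℝ} (hs0 : 0 < s) (hs1 : s ≤ 1) (K : ℝ) (c : Fin 8 → ℝ) :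
    ∃ C : ℝ, 0 ≤ C ∧ ∀ (N : ℕ) (W : C(Circ, ℂ)) (k : ℝ), W ∈ trigPoly N → wn N 10 W ≤ K →
      0 ≤ k → k ≤ 1 → series s N W c k ∈ trigPoly N ∧ ‖series s N W c k‖ ≤ C ∧
        ‖toL2 (rhs s N (series s N W c k) - rhsSeries s N W c k)‖ ≤ C * k ^ 4 := by
  have hW : BddFam (fun i : Data K => i.1.1) 10 (fun i => i.1.2.1) :=
    ⟨fun i => i.2.1, K, fun i => i.2.2.1⟩
  have hk : ∃ B : ℝ, ∀ i : Data K, |i.1.2.2| ≤ B :=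
    ⟨1, fun i => by rw [abs_of_nonneg i.2.2.2.1]; exact i.2.2.2.2⟩
  obtain ⟨hsm, B, hB⟩ := (BddFam.series hs0 hs1 hW c hk).mono (Nat.zero_le 2)
  obtain ⟨E, ⟨hEm, B', hB'⟩, hE⟩ := exists_rhs_series_eq hs0 hs1 hW c hk
  refine ⟨max (max B (3 * B')) 0, le_max_right _ _, fun N W k hWm hWK hk0 hk1 => ?_⟩
  have hm := hsm ⟨(N, W, k), hWm, hWK, hk0, hk1⟩
  have hb := hB ⟨(N, W, k), hWm, hWK, hk0, hk1⟩
  have he := hE ⟨(N, W, k), hWm, hWK, hk0, hk1⟩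
  have hem := hEm ⟨(N, W, k), hWm, hWK, hk0, hk1⟩
  have heb := hB' ⟨(N, W, k), hWm, hWK, hk0, hk1⟩
  generalize E ⟨(N, W, k), hWm, hWK, hk0, hk1⟩ = e at he hem heb
  dsimp only at hm hb he hem heb
  refine ⟨hm, (norm_le_wn hm).trans (hb.trans ?_), ?_⟩
  · exact (le_max_left _ _).trans (le_max_left _ _)
  · have h1 : rhs s N (series s N W c k) - rhsSeries s N W c k = k ^ 4 • e :=
      sub_eq_iff_eq_add'.2 he
    rw [h1, map_smul, norm_smul, Real.norm_of_nonneg (by positivity), mul_comm]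
    gcongr
    refine (norm_toL2_le _).trans ?_
    refine (mul_le_mul sqrt_two_pi_le ((norm_le_wn hem).trans heb) (norm_nonneg _)
      (by norm_num)).trans ?_
    exact (le_max_right _ _).trans (le_max_left _ _)

/-! ### The truncated flow -/

/-- The exact semidiscrete solution agrees with its fourth-order Taylor polynomial up to `O(k⁵)`. -/
theorem exists_flow_error {s : ℝ} (hs0 : 0 < s) (hs1 : s ≤ 1) (K : ℝ) :
    ∃ C : ℝ, ∀ (N : ℕ) (T : ℝ) (u₀ : C(Circ, ℂ)) (uN : ℝ → C(Circ, ℂ)),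
      IsSemidiscrete s N T u₀ uN → (∀ t ∈ Set.Icc 0 T, wn N 10 (uN t) ≤ K) →
      ∀ t k : ℝ, 0 ≤ t → 0 < k → k ≤ 1 → t + k ≤ T →
        ‖toL2 (uN (t + k) - series s N (uN t) flowCoeff k)‖ ≤ C * k ^ 5 := by
  obtain ⟨C, hC0, hC⟩ := exists_series_bound hs0 hs1 K flowCoeff
  refine ⟨Real.exp (3 / 2 * (K ^ 2 + C ^ 2) + C + 1), fun N T u₀ uN hN hK t k ht hk hk1 hT => ?_⟩
  have htT : t ∈ Set.Icc 0 T := ⟨ht, by linarith⟩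
  have hsub : Set.Icc t (t + k) ⊆ Set.Icc 0 T := Set.Icc_subset_Icc ht hT
  set W := uN t with hW
  -- The residual `C k⁴` is at most `(C / k) ‖e‖` once `‖e‖ ≥ k⁵`; over a time interval of length
  -- `k` the rate `C / k` costs only the factor `exp C`.
  set κ : ℝ := 3 / 2 * (K ^ 2 + C ^ 2) + C / k + 1 with hκ
  have hκ0 : 0 ≤ κ := by positivity
  have hser : ∀ r ∈ Set.Icc t (t + k), _ := fun r hr =>
    hC N W (r - t) (hN.mem t htT) (hK t htT) (by linarith [hr.1]) (by linarith [hr.2])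
  have key := norm_toL2_le_exp (e := fun r => uN r - series s N W flowCoeff (r - t))
    (e' := fun r => rhs s N (uN r) - rhsSeries s N W flowCoeff (r - t))
    (a := t) (b := t + k) (η := k ^ 5) (κ := κ) (by positivity) hκ0 ?_ ?_ ?_
    (t + k) ⟨by linarith, le_rfl⟩
  · simp only [add_sub_cancel_left] at key
    refine key.trans ?_
    rw [mul_comm]
    gcongr
    have : κ * k = (3 / 2 * (K ^ 2 + C ^ 2) + 1) * k + C := by rw [hκ]; field_simp; ring
    rw [this]
    nlinarith [sq_nonneg K, sq_nonneg C]
  · intro r hr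
    have h1 : HasDerivAt (fun r => series s N W flowCoeff (r - t))
        (rhsSeries s N W flowCoeff (r - t)) r := by
      have h2 := (hasDerivAt_series s N W (r - t)).scomp r ((hasDerivAt_id r).sub_const t)
      rwa [one_smul] at h2
    exact ((hN.hasDeriv r (hsub hr)).mono hsub).sub h1.hasDerivWithinAt
  · have : series s N W flowCoeff 0 = W := by simp [series]
    simp only [sub_self, this]
    rw [← hW, sub_self, map_zero, norm_zero]
    positivity
  · intro r hr h1 _
    obtain ⟨hpm, hpb, hpr⟩ := hser r hr
    set p := series s N W flowCoeff (r - t) with hp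
    have hu := hN.mem r (hsub hr)
    have huK : ‖uN r‖ ≤ K := (norm_le_wn hu).trans
      ((wn_mono N (Nat.zero_le 10) _).trans (hK r (hsub hr)))
    have hsplit : rhs s N (uN r) - rhsSeries s N W flowCoeff (r - t) =
        (rhs s N (uN r) - rhs s N p) + (rhs s N p - rhsSeries s N W flowCoeff (r - t)) := by
      abel
    rw [hsplit, map_add, inner_add_right]
    set n := ‖toL2 (uN r - p)‖ with hn
    have hn0 : 0 < n := lt_of_lt_of_le (by positivity) h1
    have e1 : inner ℝ (toL2 (uN r - p)) (toL2 (rhs s N (uN r) - rhs s N p)) ≤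
        3 / 2 * (K ^ 2 + C ^ 2) * n ^ 2 := by
      refine (le_abs_self _).trans ((inner_rhs_sub_le s hu hpm).trans ?_)
      gcongr
    have e2 : inner ℝ (toL2 (uN r - p))
        (toL2 (rhs s N p - rhsSeries s N W flowCoeff (r - t))) ≤ C / k * n ^ 2 := by
      refine (real_inner_le_norm _ _).trans ?_
      have h2 : ‖toL2 (rhs s N p - rhsSeries s N W flowCoeff (r - t))‖ ≤ C / k * n := by
        calc _ ≤ C * (r - t) ^ 4 := hpr
          _ ≤ C * k ^ 4 := by
            have : 0 ≤ r - t := by linarith [hr.1]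
            gcongr
            linarith [hr.2]
          _ = C / k * k ^ 5 := by field_simp
          _ ≤ _ := by gcongr
      calc _ ≤ n * (C / k * n) := by gcongr
        _ = _ := by ring
    have : 0 < n ^ 2 := by positivity
    rw [hκ]
    nlinarith

/-! ### One stage of the composition -/

/-- A stage that starts near the series with coefficients `c` ends near the series with coefficients
`stepCoeff b c`. -/
theorem exists_stage_error {s : ℝ} (hs0 : 0 < s) (hs1 : s ≤ 1) (K b : ℝ) (c : Fin 8 → ℝ) :
    ∃ C : ℝ, 0 ≤ C ∧ ∃ k₀ : ℝ, 0 < k₀ ∧ ∀ (N : ℕ) (W Z Z' : C(Circ, ℂ)) (k : ℝ),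
      W ∈ trigPoly N → wn N 10 W ≤ K → 0 < k → k ≤ 1 → k ≤ k₀ → Z ∈ trigPoly N → Z' ∈ trigPoly N →
      Z' = Z + (k * b) • rhs s N ((1 / 2 : ℝ) • (Z' + Z)) →
      |k * b| * ‖(1 / 2 : ℝ) • (Z' + Z)‖ ^ 2 ≤ 1 / 6 →
      ‖toL2 (Z' - series s N W (stepCoeff b c) k)‖ ≤
        3 * ‖toL2 (Z - series s N W c k)‖ + C * k ^ 5 := by
  obtain ⟨C, hC0, hC⟩ := exists_series_bound hs0 hs1 K (midCoeff b c)
  obtain ⟨_, _, hCc⟩ := exists_series_bound hs0 hs1 K c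
  obtain ⟨_, _, hCs⟩ := exists_series_bound hs0 hs1 K (stepCoeff b c)
  refine ⟨2 * (|b| * C), by positivity, 1 / (2 * ((|b| + 1) * (C ^ 2 + 1))), by positivity,
    fun N W Z Z' k hW hK hk hk1 hk0 hZ hZ' h hY => ?_⟩
  obtain ⟨-, hb, hr⟩ := hC N W k hW hK hk.le hk1
  have h' : series s N W (stepCoeff b c) k = series s N W c k + (k * b) • rhs s N
      ((1 / 2 : ℝ) • (series s N W (stepCoeff b c) k + series s N W c k)) +
      -((k * b) • (rhs s N (series s N W (midCoeff b c) k) -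
        rhsSeries s N W (midCoeff b c) k)) := by
    rw [series_midCoeff]
    conv_lhs => rw [series_stepCoeff_sub]
    module
  refine (norm_toL2_step_sub_le hZ hZ' (hCc N W k hW hK hk.le hk1).1
    (hCs N W k hW hK hk.le hk1).1 h h' ?_).trans ?_
  · rw [series_midCoeff]
    have e1 : |k * b| * ‖series s N W (midCoeff b c) k‖ ^ 2 ≤ 1 / 2 := by
      calc _ ≤ (k * (|b| + 1)) * (C ^ 2 + 1) := by
            rw [abs_mul, abs_of_pos hk]
            have : ‖series s N W (midCoeff b c) k‖ ^ 2 ≤ C ^ 2 := by gcongr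
            gcongr
            · linarith
            · linarith
        _ = k * ((|b| + 1) * (C ^ 2 + 1)) := by ring
        _ ≤ 1 / (2 * ((|b| + 1) * (C ^ 2 + 1))) * ((|b| + 1) * (C ^ 2 + 1)) := by gcongr
        _ = 1 / 2 := by field_simp
    linarith
  · rw [map_neg, norm_neg, map_smul, norm_smul, Real.norm_eq_abs, abs_mul, abs_of_pos hk]
    have : k * |b| * ‖toL2 (rhs s N (series s N W (midCoeff b c) k) -
        rhsSeries s N W (midCoeff b c) k)‖ ≤ k * |b| * (C * k ^ 4) := by gcongr
    linarith

/-! ### Order conditions -/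

/-- With `b₁ = b₃ = a` and `b₂ = 1 - 2a`, all order conditions up to order four reduce to
`b₁³ + b₂³ + b₃³ = 0`. -/
theorem stepCoeff_comp {a : ℝ} (ha : 2 * a ^ 3 + (1 - 2 * a) ^ 3 = 0) :
    stepCoeff a (stepCoeff (1 - 2 * a) (stepCoeff a 0)) = flowCoeff := by
  funext i
  fin_cases i <;> simp [stepCoeff, midCoeff, flowCoeff]
  · ring
  · ring
  · linear_combination 1 / 12 * ha
  · linear_combination -1 / 12 * ha
  · linear_combination 1 / 12 * ha
  · linear_combination 1 / 24 * ha
  · ring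
  · linear_combination -1 / 8 * ha

theorem two_rpow_third_cube : ((2 : ℝ) ^ (1 / 3 : ℝ)) ^ 3 = 2 := by
  rw [← Real.rpow_natCast, ← Real.rpow_mul (by norm_num)]; norm_num

theorem two_sub_two_rpow_third_ne_zero : 2 - (2 : ℝ) ^ (1 / 3 : ℝ) ≠ 0 := by
  intro h
  have h2 : (2 : ℝ) ^ (1 / 3 : ℝ) = 2 := by linarith
  have hθ := two_rpow_third_cube
  rw [h2] at hθ
  norm_num at hθ

theorem yoshida_zero_cube : 2 * yoshida 0 ^ 3 + (1 - 2 * yoshida 0) ^ 3 = 0 := by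
  have hne := two_sub_two_rpow_third_ne_zero
  simp only [yoshida, Matrix.cons_val_zero]
  field_simp
  linear_combination -two_rpow_third_cube

theorem yoshida_one : yoshida 1 = 1 - 2 * yoshida 0 := by
  have hne := two_sub_two_rpow_third_ne_zero
  simp only [yoshida, Matrix.cons_val_zero, Matrix.cons_val_one]
  field_simp
  ring

theorem yoshida_two : yoshida 2 = yoshida 0 := by simp [yoshida]

/-! ### The local error -/

/-- The bound on `k |b| ‖Y‖²` at the midpoint `Y` of a stage, for all `s`. -/
theorem exists_midpoint_bound {s : ℝ} (R₀ : ℝ) :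
    ∃ κ₀ : ℝ, 0 < κ₀ ∧ ∀ (k b R : ℝ) (N : ℕ) (Z Z' : C(Circ, ℂ)), 0 < k → |k * b| ≤ κ₀ → 1 ≤ N →
      Z ∈ trigPoly N → Z' ∈ trigPoly N →
      Z' = Z + (k * b) • rhs s N ((1 / 2 : ℝ) • (Z' + Z)) → ‖toL2 Z‖ = R → R ≤ R₀ →
      (1 / 2 < s ∨ 3 * R ^ 2 * k * N * |b| < 1) →
      |k * b| * ‖(1 / 2 : ℝ) • (Z' + Z)‖ ^ 2 ≤ 1 / 6 := by
  rcases lt_or_ge (1 / 2) s with hs | hs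
  · obtain ⟨κ₀, h0, h⟩ := exists_mul_norm_midpoint_sq_le (R₀ := R₀) hs
    exact ⟨κ₀, h0, fun k b R N Z Z' _ hκ _ hZ hZ' hstep hR hR₀ _ =>
      h (k * b) N Z Z' hκ hZ hZ' hstep (hR.trans_le hR₀)⟩
  · exact ⟨1, one_pos, fun k b R N Z Z' hk _ hN hZ hZ' hstep hR _ hor =>
      mul_norm_midpoint_sq_le_of_cfl hk hN hZ hZ' hstep hR
        (hor.resolve_left (not_lt.2 hs))⟩

end

end FNLS

open FNLS in
theorem propositionA2 :
    ∃ μ₀ : ℝ, ∀ s : ℝ, 0 < s → s ≤ 1 → ∀ T : ℝ, 0 < T → ∀ μ : ℝ, μ₀ ≤ μ →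
      ∀ u : ℝ → C(FNLS.Circ, ℂ), FNLS.IsSolution s T u →
        (∀ t ∈ Set.Icc 0 T, FNLS.MemSobolev μ (u t)) →
        (∃ B : ℝ, ∀ t ∈ Set.Icc 0 T, FNLS.sobolevNorm μ (u t) ≤ B) →
        ∃ k₀ : ℝ, 0 < k₀ ∧ ∃ C : ℝ,
          ∀ N : ℕ, 1 ≤ N → ∀ uN : ℝ → C(FNLS.Circ, ℂ),
            FNLS.IsSemidiscrete s N T (u 0) uN →
            ∀ (k : ℝ) (M : ℕ), 0 < k → k ≤ k₀ → (M : ℝ) * k = T →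
              (1 / 2 < s ∨ ∀ j : Fin 3,
                3 * FNLS.l2Norm (FNLS.proj N (u 0)) ^ 2 * k * N * |FNLS.yoshida j| < 1) →
              ∀ n : ℕ, n < M → ∀ Z : Fin 4 → C(FNLS.Circ, ℂ),
                FNLS.IsStages FNLS.yoshida s N k (uN (n * k)) Z →
                FNLS.l2Norm (uN ((n + 1) * k) - Z 3) ≤ C * k ^ 5 := by
  refine ⟨12, fun s hs0 hs1 T hT μ hμ u hu hm ⟨B, hB⟩ => ?_⟩
  obtain ⟨K, hK0, hK⟩ := exists_wn_le hT.le hμ hu hm hB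
  obtain ⟨κ₀, hκ₀, hmid⟩ := exists_midpoint_bound (s := s) (3 * K)
  set c₁ := stepCoeff (yoshida 0) 0 with hc₁
  set c₂ := stepCoeff (yoshida 1) c₁ with hc₂
  have hc₃ : stepCoeff (yoshida 2) c₂ = flowCoeff := by
    rw [hc₂, hc₁, yoshida_two, yoshida_one]
    exact stepCoeff_comp yoshida_zero_cube
  obtain ⟨C₁, hC₁, k₁, hk₁, h₁⟩ := exists_stage_error hs0 hs1 K (yoshida 0) 0
  obtain ⟨C₂, hC₂, k₂, hk₂, h₂⟩ := exists_stage_error hs0 hs1 K (yoshida 1) c₁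
  obtain ⟨C₃, hC₃, k₃, hk₃, h₃⟩ := exists_stage_error hs0 hs1 K (yoshida 2) c₂
  obtain ⟨C₄, hflow⟩ := exists_flow_error hs0 hs1 K
  set β : ℝ := 1 + ∑ j, |yoshida j| with hβ
  have hβ0 : 0 < β := by positivity
  have hβj : ∀ j, |yoshida j| ≤ β := fun j =>
    (Finset.single_le_sum (f := fun j => |yoshida j|) (fun _ _ => abs_nonneg _)
      (Finset.mem_univ j)).trans (by rw [hβ]; linarith)
  refine ⟨min 1 (min (κ₀ / β) (min k₁ (min k₂ k₃))), by positivity,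
    C₄ + (9 * C₁ + 3 * C₂ + C₃), fun N hN uN hsd k M hk hkk hMT hor n hn Z hZ => ?_⟩
  simp only [le_min_iff] at hkk
  obtain ⟨hk1, hkκ, hkk₁, hkk₂, hkk₃⟩ := hkk
  have hbd := hK N uN hsd
  have hnT : (n : ℝ) * k + k ≤ T := by
    rw [← hMT]
    have : (n : ℝ) + 1 ≤ M := by exact_mod_cast hn
    nlinarith
  have hn0 : 0 ≤ (n : ℝ) * k := by positivity
  have htn : (n : ℝ) * k ∈ Set.Icc 0 T := ⟨hn0, by linarith⟩
  set W := uN (n * k) with hW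
  have hWm : W ∈ trigPoly N := hsd.mem _ htn
  have hWK : wn N 10 W ≤ K := hbd _ htn
  rw [l2Norm_eq] at hor ⊢
  set R := ‖toL2 (proj N (u 0))‖ with hR
  have hWR : ‖toL2 W‖ = R := norm_toL2_const hsd _ htn
  have hRK : R ≤ 3 * K := by
    rw [← hWR]
    exact (norm_toL2_le _).trans (mul_le_mul sqrt_two_pi_le ((norm_le_wn hWm).trans
      ((wn_mono N (Nat.zero_le 10) _).trans hWK)) (norm_nonneg _) (by norm_num))
  have hkb : ∀ j, |k * yoshida j| ≤ κ₀ := fun j => by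
    rw [abs_mul, abs_of_pos hk]
    calc k * |yoshida j| ≤ κ₀ / β * β := by gcongr; exact hβj j
      _ = κ₀ := by field_simp
  have hor' : ∀ j, 1 / 2 < s ∨ 3 * R ^ 2 * k * N * |yoshida j| < 1 := fun j =>
    hor.imp_right fun h => h j
  have s₁ : Z 1 = Z 0 + (k * yoshida 0) • rhs s N ((1 / 2 : ℝ) • (Z 1 + Z 0)) := hZ.step 0
  have s₂ : Z 2 = Z 1 + (k * yoshida 1) • rhs s N ((1 / 2 : ℝ) • (Z 2 + Z 1)) := hZ.step 1
  have s₃ : Z 3 = Z 2 + (k * yoshida 2) • rhs s N ((1 / 2 : ℝ) • (Z 3 + Z 2)) := hZ.step 2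
  have r₀ : ‖toL2 (Z 0)‖ = R := by rw [hZ.zero, hWR]
  have r₁ : ‖toL2 (Z 1)‖ = R := (norm_toL2_step (hZ.mem 0) (hZ.mem 1) s₁).trans r₀
  have r₂ : ‖toL2 (Z 2)‖ = R := (norm_toL2_step (hZ.mem 1) (hZ.mem 2) s₂).trans r₁
  have e₁ := h₁ N W (Z 0) (Z 1) k hWm hWK hk hk1 hkk₁ (hZ.mem 0) (hZ.mem 1) s₁
    (hmid k _ R N _ _ hk (hkb 0) hN (hZ.mem 0) (hZ.mem 1) s₁ r₀ hRK (hor' 0))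
  have e₂ := h₂ N W (Z 1) (Z 2) k hWm hWK hk hk1 hkk₂ (hZ.mem 1) (hZ.mem 2) s₂
    (hmid k _ R N _ _ hk (hkb 1) hN (hZ.mem 1) (hZ.mem 2) s₂ r₁ hRK (hor' 1))
  have e₃ := h₃ N W (Z 2) (Z 3) k hWm hWK hk hk1 hkk₃ (hZ.mem 2) (hZ.mem 3) s₃
    (hmid k _ R N _ _ hk (hkb 2) hN (hZ.mem 2) (hZ.mem 3) s₃ r₂ hRK (hor' 2))
  rw [series_zero, hZ.zero, sub_self, map_zero, norm_zero] at e₁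
  rw [hc₃] at e₃
  have e₄ := hflow N T (u 0) uN hsd hbd (n * k) k hn0 hk hk1 hnT
  have hsplit : uN ((n + 1) * k) - Z 3 =
      (uN (n * k + k) - series s N W flowCoeff k) - (Z 3 - series s N W flowCoeff k) := by
    rw [add_mul, one_mul]; abel
  rw [hsplit, map_sub]
  refine (norm_sub_le _ _).trans ?_
  linarith
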